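/- Let $p\ge 2$ be an integer (for example a prime). Let $\mathrm{CMon}$ be the $\infty$-category of commutative ($\mathbb E_\infty$-) monoids in spaces. For $M\in\mathrm{CMon}$, let $p\colon M\to M$ be the Frobenius map, i.e. the composite $M\xrightarrow{\Delta}M^p\xrightarrow{+}M$ of the diagonal and the addition, regarded as a map of commutative monoids. Call $M$ $p$-perfect if $p\colon M\to M$ is an equivalence, let $M\to M[\tfrac1p]$ be the reflection of $M$ into the full subcategory of $p$-perfect commutative monoids, and let $$\mathrm{tel}_p(M)=\mathrm{colim}\,(M\xrightarrow{p}M\xrightarrow{p}M\to\cdots)$$ be the colimit in $\mathrm{CMon}$. Let $\mathrm{Fin}^{\simeq}$ be the groupoid of finite sets and bijections, a commutative monoid under disjoint union. Then: 1. the commutative monoid $\mathrm{tel}_p(\mathrm{Fin}^{\simeq})$ is not $p$-perfect; 2. the canonical map $\mathrm{tel}_p(\mathrm{Fin}^{\simeq})\to\mathrm{Fin}^{\simeq}[\tfrac1p]$, i.e. the map under $\mathrm{Fin}^{\simeq}$, is not an equivalence; 3. if $\underline 1\in\mathrm{tel}_p(\mathrm{Fin}^{\simeq})$ denotes the image of the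 one-element set $1\in\mathrm{Fin}^{\simeq}$ at the first stage, then the symmetric group $\Sigma_p$ embeds in $\pi_1(\mathrm{tel}_p(\mathrm{Fin}^{\simeq}),\underline 1)$, and this group is not abelian. -/

import Mathlib

namespace EInfty

open CategoryTheory Limits Simplicial MonoidalCategory

/-!
Commutative monoids (`E_∞`-monoids) in the `∞`-category of spaces are functors `X` from finite
pointed sets to spaces that satisfy the Segal condition. They are modelled by special Γ-spaces with
values in simplicial sets, localized at the levelwise weak equivalences. The category `HoGamma`
below is the homotopy category of all functors from finite pointed sets to spaces; the homotopy
category of commutative monoids is its full subcategory of special Γ-spaces, and a morphism of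
commutative monoids is an equivalence if and only if it is an isomorphism in `HoGamma`.
-/

/-! ### Finite pointed sets -/

/-- Objects of the category of finite pointed sets: the finite set `I` stands for `I₊ = I ⊔ {*}`. -/
structure FinStar where
  carrier : Type
  finite : Finite carrier

attribute [instance] FinStar.finite

/-- Pointed maps `I₊ → J₊`, with `Option.none` as base point. -/
@[ext]
structure FinStar.Hom (I J : FinStar) where
  toFun : Option I.carrier → Option J.carrier
  map_none : toFun none = none

instance : Category FinStar where
  Hom := FinStar.Hom
  id I := ⟨fun x => x, rfl⟩
  comp f g := ⟨fun x => g.toFun (f.toFun x), by rw [f.map_none, g.map_none]⟩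

namespace FinStar

@[ext]
lemma hom_ext {I J : FinStar} {f g : I ⟶ J} (h : ∀ x, f.toFun x = g.toFun x) : f = g :=
  Hom.ext (funext h)

@[simp]
lemma id_toFun {I : FinStar} (x : Option I.carrier) : Hom.toFun (𝟙 I) x = x := rfl

@[simp]
lemma comp_toFun {I J K : FinStar} (f : I ⟶ J) (g : J ⟶ K) (x : Option I.carrier) :
    Hom.toFun (f ≫ g) x = g.toFun (f.toFun x) := rfl

/-- The one-element set, standing for `{1}₊`. -/
def pt : FinStar := ⟨Unit, inferInstance⟩

open Classical in
/-- The Segal map `I₊ → {1}₊` that sends `i` to `1` and everything else to the base point. -/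
noncomputable def proj {I : FinStar} (i : I.carrier) : I ⟶ pt :=
  ⟨fun x => if x = some i then some () else none, by simp⟩

lemma proj_some_self {I : FinStar} (i : I.carrier) : (proj i).toFun (some i) = some () :=
  if_pos rfl

lemma proj_of_ne {I : FinStar} {i : I.carrier} {x : Option I.carrier} (h : x ≠ some i) :
    (proj i).toFun x = none :=
  if_neg h

/-- The functor `I₊ ↦ {1, …, p}₊ ∧ I₊`. -/
def smash (p : ℕ) : FinStar ⥤ FinStar where
  obj I := ⟨Fin p × I.carrier, inferInstance⟩
  map f := ⟨fun x => x.bind fun y => (f.toFun (some y.2)).map fun z => (y.1, z), rfl⟩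
  map_id I := by
    ext1 x
    cases x <;> rfl
  map_comp f g := by
    ext1 x
    rcases x with _ | y
    · rfl
    · change ((g.toFun (f.toFun (some y.2))).map fun z => (y.1, z)) = _
      simp only [comp_toFun, Option.bind_some]
      cases f.toFun (some y.2)
      · simp [g.map_none]
      · simp

/-- The map `{1, …, p}₊ ∧ I₊ → I₊` that keeps the `k`-th copy of `I`
and sends the other copies to the base point. -/
def smashProj (p : ℕ) (k : Fin p) : smash p ⟶ 𝟭 FinStar where
  app I := ⟨fun x => x.bind fun y => if y.1 = k then some y.2 else none, rfl⟩
  naturality I J f := by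
    ext1 x
    rcases x with _ | ⟨j, y⟩
    · exact f.map_none.symm
    · change ((f.toFun (some y)).map fun z => (j, z)).bind (fun y => if y.1 = k then some y.2 else none) =
        f.toFun (if j = k then some y else none)
      by_cases hj : j = k
      · cases h : f.toFun (some y) <;> simp [hj, h]
      · cases h : f.toFun (some y) <;> simp [hj, f.map_none]

/-- The fold map `{1, …, p}₊ ∧ I₊ → I₊`. -/
def smashFold (p : ℕ) : smash p ⟶ 𝟭 FinStar where
  app I := ⟨fun x => x.map Prod.snd, rfl⟩
  naturality I J f := by
    ext1 x
    rcases x with _ | ⟨j, y⟩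
    · exact f.map_none.symm
    · change ((f.toFun (some y)).map fun z => (j, z)).map Prod.snd = f.toFun (some y)
      simp

end FinStar

/-! ### Simplicial sets -/

/-- Constructor for homotopies. -/
def mkHomotopy {X Y : SSet.{0}} {f g : X ⟶ Y} (h : X ⊗ Δ[1] ⟶ Y)
    (h₀ : SSet.ι₀ ≫ h = f) (h₁ : SSet.ι₁ ≫ h = g) : SSet.Homotopy f g where
  h := h
  h₀ := h₀
  h₁ := h₁
  rel := by
    ext n ⟨⟨x, hx⟩, y⟩
    exact False.elim (by simp at hx)

/-- The set `[X, K]` of homotopy classes of maps of simplicial sets (the quotient by the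
equivalence relation generated by simplicial homotopies `X × Δ[1] → K`). -/
def HoClass (X K : SSet.{0}) : Type :=
  Quot fun f g : X ⟶ K => Nonempty (SSet.Homotopy f g)

/-- The homotopy class of a map. -/
def HoClass.mk {X K : SSet.{0}} (f : X ⟶ K) : HoClass X K := Quot.mk _ f

lemma homotopic_precomp {X Y K : SSet.{0}} (f : X ⟶ Y) {g h : Y ⟶ K}
    (H : Nonempty (SSet.Homotopy g h)) : Nonempty (SSet.Homotopy (f ≫ g) (f ≫ h)) := by
  obtain ⟨H⟩ := H
  refine ⟨mkHomotopy (f ▷ Δ[1] ≫ H.h) ?_ ?_⟩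
  · exact Eq.trans rfl (congrArg (f ≫ ·) H.h₀)
  · exact Eq.trans rfl (congrArg (f ≫ ·) H.h₁)

/-- The map `[Y, K] → [X, K]` induced by `f : X ⟶ Y`. -/
def HoClass.precomp {X Y : SSet.{0}} (f : X ⟶ Y) (K : SSet.{0}) : HoClass Y K → HoClass X K :=
  Quot.map (fun g => f ≫ g) fun _ _ H => homotopic_precomp f H

/-- Weak homotopy equivalences of simplicial sets: the maps `f : X ⟶ Y` such that
`[Y, K] → [X, K]` is bijective for every Kan complex `K`. -/
def weakEq : MorphismProperty SSet.{0} := fun _ _ f =>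
  ∀ K : SSet.{0}, SSet.KanComplex K → Function.Bijective (HoClass.precomp f K)

lemma precomp_comp {X Y Z : SSet.{0}} (f : X ⟶ Y) (g : Y ⟶ Z) (K : SSet.{0}) :
    HoClass.precomp (f ≫ g) K = HoClass.precomp f K ∘ HoClass.precomp g K := by
  funext x
  induction x using Quot.ind
  exact congrArg (Quot.mk _) (Category.assoc _ _ _)

lemma weakEq_comp {X Y Z : SSet.{0}} {f : X ⟶ Y} {g : Y ⟶ Z} (hf : weakEq f) (hg : weakEq g) :
    weakEq (f ≫ g) := fun K hK => by
  rw [precomp_comp]; exact (hf K hK).comp (hg K hK)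

lemma weakEq_of_postcomp {X Y Z : SSet.{0}} {f : X ⟶ Y} {g : Y ⟶ Z} (hg : weakEq g)
    (h : weakEq (f ≫ g)) : weakEq f := fun K hK => by
  have := h K hK
  rw [precomp_comp] at this
  exact (Function.Bijective.of_comp_iff _ (hg K hK)).1 this

/-- The relation generated by homotopies. -/
abbrev HoEq {X K : SSet.{0}} (f g : X ⟶ K) : Prop :=
  Relation.EqvGen (fun f g : X ⟶ K => Nonempty (SSet.Homotopy f g)) f g

lemma mk_eq_iff {X K : SSet.{0}} (f g : X ⟶ K) : HoClass.mk f = HoClass.mk g ↔ HoEq f g :=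
  Quot.eq

lemma HoEq.postcomp {X Y K : SSet.{0}} {f g : X ⟶ Y} (H : HoEq f g) (u : Y ⟶ K) :
    HoEq (f ≫ u) (g ≫ u) := by
  induction H with
  | rel f g h =>
    obtain ⟨h⟩ := h
    refine .rel _ _ ⟨mkHomotopy (h.h ≫ u) ?_ ?_⟩
    · rw [← Category.assoc, h.h₀]
    · rw [← Category.assoc, h.h₁]
  | refl f => exact .refl _
  | symm f g _ ih => exact ih.symm
  | trans f g h _ _ ih ih' => exact ih.trans _ _ _ ih'

lemma HoEq.precomp {X Y K : SSet.{0}} {f g : X ⟶ Y} (H : HoEq f g) (u : K ⟶ X) :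
    HoEq (u ≫ f) (u ≫ g) := by
  induction H with
  | rel f g h => exact .rel _ _ (homotopic_precomp u h)
  | refl f => exact .refl _
  | symm f g _ ih => exact ih.symm
  | trans f g h _ _ ih ih' => exact ih.trans _ _ _ ih'

lemma weakEq_iff {X Y : SSet.{0}} (f : X ⟶ Y) : weakEq f ↔ ∀ K : SSet.{0}, SSet.KanComplex K →
    (∀ g h : Y ⟶ K, HoEq (f ≫ g) (f ≫ h) → HoEq g h) ∧ ∀ g : X ⟶ K, ∃ h : Y ⟶ K, HoEq (f ≫ h) g := by
  refine forall₂_congr fun K _ => and_congr ⟨fun H g h e => ?_, fun H x y e => ?_⟩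
    ⟨fun H g => ?_, fun H x => ?_⟩
  · exact (mk_eq_iff _ _).1 (H ((mk_eq_iff _ _).2 e : HoClass.mk (f ≫ g) = HoClass.mk (f ≫ h)))
  · induction x using Quot.ind with | mk g
    induction y using Quot.ind with | mk h
    exact (mk_eq_iff _ _).2 (H g h ((mk_eq_iff _ _).1 e))
  · obtain ⟨x, hx⟩ := H (HoClass.mk g)
    induction x using Quot.ind with | mk h
    exact ⟨h, (mk_eq_iff _ _).1 hx⟩
  · induction x using Quot.ind with | mk g
    obtain ⟨h, hh⟩ := H g
    exact ⟨HoClass.mk h, (mk_eq_iff _ _).2 hh⟩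

/-- Homotopy equivalences are weak equivalences. -/
lemma weakEq_of_hoEq {X Y : SSet.{0}} (f : X ⟶ Y) (g : Y ⟶ X) (h₁ : HoEq (f ≫ g) (𝟙 X))
    (h₂ : HoEq (g ≫ f) (𝟙 Y)) : weakEq f := by
  rw [weakEq_iff]
  refine fun K _ => ⟨fun u v e => ?_, fun u => ⟨g ≫ u, ?_⟩⟩
  · have hu := h₂.postcomp u
    have hv := h₂.postcomp v
    have := e.precomp g
    simp only [Category.assoc, Category.id_comp] at hu hv this
    exact (hu.symm.trans _ _ _ this).trans _ _ _ hv
  · simpa using h₁.postcomp u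

lemma weakEq_of_iso {X Y : SSet.{0}} (e : X ≅ Y) : weakEq e.hom :=
  weakEq_of_hoEq e.hom e.inv (by rw [e.hom_inv_id]; exact .refl _)
    (by rw [e.inv_hom_id]; exact .refl _)

lemma HoEq.curry {X A K : SSet.{0}} {f g : A ⊗ X ⟶ K} (H : HoEq f g) :
    HoEq (MonoidalClosed.curry f) (MonoidalClosed.curry g) := by
  induction H with
  | rel f g h =>
    obtain ⟨h⟩ := h
    refine .rel _ _ ⟨mkHomotopy (MonoidalClosed.curry ((α_ _ _ _).inv ≫ h.h)) ?_ ?_⟩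
    · rw [← MonoidalClosed.curry_natural_left]
      congr 1
      exact Eq.trans rfl h.h₀
    · rw [← MonoidalClosed.curry_natural_left]
      congr 1
      exact Eq.trans rfl h.h₁
  | refl f => exact .refl _
  | symm f g _ ih => exact ih.symm
  | trans f g h _ _ ih ih' => exact ih.trans _ _ _ ih'

lemma HoEq.uncurry {X A K : SSet.{0}} {f g : X ⟶ (ihom A).obj K} (H : HoEq f g) :
    HoEq (MonoidalClosed.uncurry f) (MonoidalClosed.uncurry g) := by
  induction H with
  | rel f g h =>
    obtain ⟨h⟩ := h
    refine .rel _ _ ⟨mkHomotopy ((α_ _ _ _).hom ≫ MonoidalClosed.uncurry h.h) ?_ ?_⟩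
    · refine Eq.trans ?_ (congrArg MonoidalClosed.uncurry h.h₀)
      rw [MonoidalClosed.uncurry_natural_left]
      rfl
    · refine Eq.trans ?_ (congrArg MonoidalClosed.uncurry h.h₁)
      rw [MonoidalClosed.uncurry_natural_left]
      rfl
  | refl f => exact .refl _
  | symm f g _ ih => exact ih.symm
  | trans f g h _ _ ih ih' => exact ih.trans _ _ _ ih'

lemma weakEq_whiskerLeft (A : SSet.{0}) {X Y : SSet.{0}} {f : X ⟶ Y} (hf : weakEq f) :
    weakEq (A ◁ f) := by
  rw [weakEq_iff] at hf ⊢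
  intro K hK
  obtain ⟨h₁, h₂⟩ := hf ((ihom A).obj K) inferInstance
  refine ⟨fun g h e => ?_, fun g => ?_⟩
  · have := h₁ (MonoidalClosed.curry g) (MonoidalClosed.curry h) (by
      simpa only [MonoidalClosed.curry_natural_left] using e.curry)
    simpa using this.uncurry
  · obtain ⟨h, hh⟩ := h₂ (MonoidalClosed.curry g)
    refine ⟨MonoidalClosed.uncurry h, ?_⟩
    simpa only [MonoidalClosed.uncurry_natural_left, MonoidalClosed.uncurry_curry] using hh.uncurry

lemma weakEq_tensor {X Y X' Y' : SSet.{0}} {f : X ⟶ Y} {g : X' ⟶ Y'} (hf : weakEq f)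
    (hg : weakEq g) : weakEq (f ⊗ₘ g) := by
  rw [MonoidalCategory.tensorHom_def]
  refine weakEq_comp ?_ (weakEq_whiskerLeft _ hg)
  have : f ▷ X' = (β_ X X').hom ≫ X' ◁ f ≫ (β_ X' Y).hom := by
    rfl
  rw [this]
  exact weakEq_comp (weakEq_of_iso _) (weakEq_comp (weakEq_whiskerLeft _ hf) (weakEq_of_iso (β_ X' Y)))

/-- The power `X ^ ι` of a simplicial set. -/
def powFunctor (ι : Type) : SSet.{0} ⥤ SSet.{0} where
  obj X :=
    { obj := fun n => ι → X.obj n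
      map := fun f => ↾fun s i => X.map f (s i)
      map_id := by intros; ext; simp 
      map_comp := by intros; ext; simp  }
  map f := { app := fun n => ↾fun s i => f.app n (s i),
             naturality := by intros; ext; simp }
  map_id := by intros; rfl
  map_comp := by intros; rfl

/-- `X ^ ι` depends on `ι` only up to bijection. -/
def powIso {ι κ : Type} (e : ι ≃ κ) : powFunctor κ ≅ powFunctor ι :=
  NatIso.ofComponents (fun X => 
    { hom := { app := fun n => ↾fun s i => s (e i), naturality := by intros; rfl }
      inv := { app := fun n => ↾fun s i => s (e.symm i), naturality := by intros; rfl }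
      hom_inv_id := by
        ext n s; funext i; change s _ = s _ ; simp
      inv_hom_id := by ext n s; funext i; change s _ = s _ ; simp })
    (by intros; rfl)

/-- `X ^ ∅` does not depend on `X`. -/
def powEmptyIso (X Y : SSet.{0}) : (powFunctor PEmpty).obj X ≅ (powFunctor PEmpty).obj Y where
  hom := { app := fun n => ↾fun s i => i.elim, naturality := by intros; ext; funext i; exact i.elim }
  inv := { app := fun n => ↾fun s i => i.elim, naturality := by intros; ext; funext i; exact i.elim }
  hom_inv_id := by ext; funext i; exact i.elim
  inv_hom_id := by ext; funext i; exact i.elim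

/-- `X ^ (ι ⊔ {*}) = X × X ^ ι`. -/
def powOptionIso (ι : Type) (X : SSet.{0}) : (powFunctor (Option ι)).obj X ≅ X ⊗ (powFunctor ι).obj X where
  hom := { app := fun n => ↾fun s => (s none, fun i => s (some i)), naturality := by intros; rfl }
  inv := { app := fun n => ↾fun s i => i.elim s.1 s.2,
           naturality := by intros; ext s; funext i; cases i <;> rfl }
  hom_inv_id := by ext n s; funext i; cases i <;> rfl
  inv_hom_id := rfl

lemma weakEq_pow (ι : Type) [Finite ι] : ∀ {X Y : SSet.{0}} {f : X ⟶ Y}, weakEq f →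
    weakEq ((powFunctor ι).map f) := by
  induction ι using Finite.induction_empty_option with
  | of_equiv e ih =>
    intro X Y f hf
    rw [← NatIso.naturality_1 (powIso e.symm) f]
    exact weakEq_comp (weakEq_of_iso ((powIso e.symm).app X).symm)
      (weakEq_comp (ih hf) (weakEq_of_iso ((powIso e.symm).app Y)))
  | h_empty =>
    intro X Y f hf
    have : (powFunctor PEmpty).map f = (powEmptyIso X Y).hom := by
      ext; funext i; exact i.elim
    rw [this]
    exact weakEq_of_iso _
  | h_option ih =>
    rename_i ι _
    intro X Y f hf
    have : (powFunctor (Option ι)).map f = (powOptionIso ι X).hom ≫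
        (f ⊗ₘ (powFunctor ι).map f) ≫ (powOptionIso ι Y).inv := by
      ext n s; funext i; cases i <;> rfl
    rw [this]
    exact weakEq_comp (weakEq_of_iso _) (weakEq_comp (weakEq_tensor hf (ih hf))
      (weakEq_of_iso (powOptionIso ι Y).symm))


/-! ### Nerves -/

/-- The `n`-simplex of the nerve of the walking isomorphism with the given vertices. -/
def walkingSimplex {n : ℕ} (t : Fin (n + 1) → Fin 2) : Fin (n + 1) ⥤ WalkingIso.{0} where
  obj i := .mk (.up (t i == 1))
  map _ := (Codiscrete.iso _ _).hom

/-- The nerve of the walking isomorphism. -/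
abbrev walkingNerve : SSet.{0} := nerve WalkingIso.{0}

/-- The edge of `walkingNerve` given by the walking isomorphism. -/
def walkingEdge : Δ[1] ⟶ walkingNerve where
  app n := ↾fun s => walkingSimplex (SSet.stdSimplex.objEquiv s).toOrderHom
  naturality := by intros; rfl

/-- The two ends of the cylinder `X ⊗ walkingNerve`. -/
def walkingEnd (b : WalkingIso.{0}) (X : SSet.{0}) : X ⟶ X ⊗ walkingNerve where
  app n := ↾fun x => (x, (Functor.const _).obj b)
  naturality := by intros; rfl

lemma hoEq_of_walking {X Y : SSet.{0}} {f g : X ⟶ Y} (h : X ⊗ walkingNerve ⟶ Y)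
    (h₀ : walkingEnd .zero X ≫ h = f) (h₁ : walkingEnd .one X ≫ h = g) : HoEq f g :=
  .rel _ _ ⟨mkHomotopy (X ◁ walkingEdge ≫ h) (by rw [← h₀]; rfl) (by rw [← h₁]; rfl)⟩

section

variable {C D : Type} [SmallCategory C] [SmallCategory D]

/-- A functor on `WalkingIso × C` gives a homotopy on the nerve. -/
def nerveCyl (K : WalkingIso.{0} × C ⥤ D) : nerve C ⊗ walkingNerve ⟶ nerve D where
  app n := ↾fun s => Functor.prod' s.2 s.1 ⋙ K
  naturality := by intros; rfl

lemma walkingEnd_nerveCyl (b : WalkingIso.{0}) (K : WalkingIso.{0} × C ⥤ D) :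
    walkingEnd b _ ≫ nerveCyl K = nerveMap (Functor.prod' ((Functor.const _).obj b) (𝟭 C) ⋙ K) :=
  rfl

lemma ends_uncurry₀ {F G : C ⥤ D} (e : F ≅ G) :
    Functor.prod' ((Functor.const _).obj .zero) (𝟭 C) ⋙
      Functor.uncurry.obj (WalkingIso.fromIso.{0} e) = F :=
  CategoryTheory.Functor.ext (fun _ => rfl) (by intros; simp; exact (Category.id_comp _).symm)

lemma ends_uncurry₁ {F G : C ⥤ D} (e : F ≅ G) :
    Functor.prod' ((Functor.const _).obj .one) (𝟭 C) ⋙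
      Functor.uncurry.obj (WalkingIso.fromIso.{0} e) = G :=
  CategoryTheory.Functor.ext (fun _ => rfl) (by intros; simp; exact (Category.id_comp _).symm)

lemma hoEq_nerveMap {F G : C ⥤ D} (e : F ≅ G) : HoEq (nerveMap F) (nerveMap G) :=
  hoEq_of_walking (nerveCyl (Functor.uncurry.obj (WalkingIso.fromIso e)))
    (by rw [walkingEnd_nerveCyl, ends_uncurry₀]) (by rw [walkingEnd_nerveCyl, ends_uncurry₁])

lemma weakEq_nerveMap (F : C ⥤ D) [F.IsEquivalence] : weakEq (nerveMap F) :=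
  weakEq_of_hoEq _ (nerveMap F.inv) (hoEq_nerveMap F.asEquivalence.unitIso.symm)
    (hoEq_nerveMap F.asEquivalence.counitIso)

/-- Nerves commute with powers. -/
def nervePow (ι : Type) (C : Type) [SmallCategory C] :
    nerve (ι → C) ≅ (powFunctor ι).obj (nerve C) where
  hom := { app := fun n => ↾fun s i => s ⋙ Pi.eval (fun _ => C) i, naturality := by intros; rfl }
  inv := { app := fun n => ↾fun s => Functor.pi' s, naturality := by intros; rfl }
  hom_inv_id := rfl
  inv_hom_id := rfl


end

lemma weakEq_fst (X : SSet.{0}) :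
    weakEq (SemiCartesianMonoidalCategory.fst X walkingNerve) := by
  refine weakEq_of_hoEq _ (walkingEnd .zero X) (hoEq_of_walking
    { app := fun n => ↾fun s => (s.1.1,
        { obj := fun i => .mk (.up ((s.2.obj i).as.down && (s.1.2.obj i).as.down))
          map := fun _ => (Codiscrete.iso _ _).hom })
      naturality := by intros; rfl } rfl rfl) (.refl _)

/-! ### Commutative monoids in spaces as special Γ-spaces -/

/-- Γ-spaces: functors from finite pointed sets to simplicial sets. -/
abbrev GammaSpace : Type 1 := FinStar ⥤ SSet.{0}

/-- The Segal map `X(I₊) → X({1}₊) ^ I`, with components induced by the maps `I₊ → {1}₊`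
that keep one element of `I`. -/
noncomputable def segalMap (X : GammaSpace) (I : FinStar) :
    X.obj I ⟶ (powFunctor I.carrier).obj (X.obj .pt) where
  app n := ↾fun x i => (X.map (FinStar.proj i)).app n x
  naturality := by intros; ext; funext i; simp [powFunctor]

/-- The Segal condition: `X(I₊) → X({1}₊) ^ I` is a weak equivalence for every finite set `I`.
A special Γ-space is a commutative monoid in spaces, with underlying space `X({1}₊)`. -/
def IsSpecial (X : GammaSpace) : Prop :=
  ∀ I : FinStar, weakEq (segalMap X I)

/-- Levelwise weak equivalences of Γ-spaces. -/
def levelwiseWeakEq : MorphismProperty GammaSpace := fun _ _ f =>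
  ∀ I : FinStar, weakEq (f.app I)

/-- The homotopy category of Γ-spaces: the localization at the levelwise weak equivalences. -/
abbrev HoGamma := levelwiseWeakEq.Localization

/-- The localization functor. -/
abbrev toHo : GammaSpace ⥤ HoGamma := levelwiseWeakEq.Q

/-- The power `X ^ p` in Γ-spaces. -/
abbrev power (p : ℕ) (X : GammaSpace) : GammaSpace := X ⋙ powFunctor (Fin p)

/-- The diagonal `X → X ^ p`. -/
def diagonal (p : ℕ) (X : GammaSpace) : X ⟶ power p X where
  app I := { app := fun n => ↾fun x _ => x, naturality := by intros; rfl }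
  naturality := by intros; rfl

/-- The map with components `X({1, …, p}₊ ∧ I₊) → X(I₊) ^ p`. -/
def smashSegal (p : ℕ) (X : GammaSpace) : FinStar.smash p ⋙ X ⟶ power p X where
  app I := { app := fun n => ↾fun x k => (X.map ((FinStar.smashProj p k).app I)).app n x,
             naturality := by intros; ext; funext i; simp [powFunctor] }
  naturality I J f := by
    ext n x
    funext k
    have := congrArg (fun g => X.map g) ((FinStar.smashProj p k).naturality f)
    simp only [Functor.map_comp] at this
    exact congrArg (fun g : X.obj _ ⟶ X.obj _ => g.app n x) this

/-- The map `X({1, …, p}₊ ∧ I₊) → X(I₊)` induced by the fold map. Through the equivalence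
`smashSegal` it is the addition `X ^ p → X`. -/
def foldMap (p : ℕ) (X : GammaSpace) : FinStar.smash p ⋙ X ⟶ X :=
  Functor.whiskerRight (FinStar.smashFold p) X

/-- `(X ^ A) ^ B = X ^ (B × A)`. -/
def powPow (A B : Type) (X : SSet.{0}) :
    (powFunctor B).obj ((powFunctor A).obj X) ≅ (powFunctor (B × A)).obj X where
  hom := { app := fun n => ↾fun s i => s i.1 i.2, naturality := by intros; rfl }
  inv := { app := fun n => ↾fun s b a => s (b, a), naturality := by intros; rfl }
  hom_inv_id := rfl
  inv_hom_id := rfl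

lemma smashProj_proj (p : ℕ) (I : FinStar) (k : Fin p) (i : I.carrier) :
    (FinStar.smashProj p k).app I ≫ FinStar.proj i =
      FinStar.proj (I := (FinStar.smash p).obj I) (k, i) := by
  ext1 x
  rcases x with _ | ⟨j, y⟩
  · rw [FinStar.Hom.map_none, FinStar.Hom.map_none]
  · change (FinStar.proj i).toFun (if j = k then some y else none) = _
    by_cases hj : j = k
    · subst hj
      by_cases hy : y = i
      · subst hy
        rw [if_pos rfl, FinStar.proj_some_self]
        exact (FinStar.proj_some_self (I := (FinStar.smash p).obj I) (j, y)).symm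
      · rw [if_pos rfl, FinStar.proj_of_ne (fun h => hy (Option.some.inj h))]
        exact (FinStar.proj_of_ne (I := (FinStar.smash p).obj I) (i := (j, i)) (x := some (j, y))
          (fun h => hy (congrArg Prod.snd (Option.some.inj h)))).symm
    · rw [if_neg hj, FinStar.Hom.map_none]
      exact (FinStar.proj_of_ne (I := (FinStar.smash p).obj I) (i := (k, i)) (x := some (j, y))
        (fun h => hj (congrArg Prod.fst (Option.some.inj h)))).symm

lemma smashSegal_weakEq (p : ℕ) {X : GammaSpace} (hX : IsSpecial X) :
    levelwiseWeakEq (smashSegal p X) := by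
  intro I
  refine weakEq_of_postcomp (weakEq_pow (Fin p) (hX I)) ?_
  have : (smashSegal p X).app I ≫ (powFunctor (Fin p)).map (segalMap X I) =
      segalMap X ((FinStar.smash p).obj I) ≫ (powPow I.carrier (Fin p) (X.obj .pt)).inv := by
    ext n x
    funext k i
    have := congrArg (fun g => X.map g) (smashProj_proj p I k i)
    simp only [Functor.map_comp] at this
    exact congrArg (fun g : X.obj _ ⟶ X.obj _ => g.app n x) this
  rw [this]
  exact weakEq_comp (hX _) (weakEq_of_iso (powPow I.carrier (Fin p) (X.obj .pt)).symm)

/-- The Frobenius map `p : X → X` of a commutative monoid, as a map of commutative monoids: the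
diagonal `X → X ^ p` followed by the addition `X ^ p ≃ X({1, …, p}₊ ∧ -) → X`. -/
noncomputable def frobenius (p : ℕ) (X : GammaSpace) (hX : IsSpecial X) :
    toHo.obj X ⟶ toHo.obj X :=
  toHo.map (diagonal p X) ≫
    (Localization.isoOfHom toHo levelwiseWeakEq (smashSegal p X) (smashSegal_weakEq p hX)).inv ≫
    toHo.map (foldMap p X)

/-- `X` is a `p`-perfect commutative monoid: `p : X → X` is an equivalence. -/
def IsPPerfect (p : ℕ) (X : GammaSpace) : Prop :=
  ∃ hX : IsSpecial X, IsIso (frobenius p X hX)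

/-- The map `η : M → L` exhibits `L` as the `p`-perfection `M[1/p]`: it is the reflection of `M`
into `p`-perfect commutative monoids. The universal property is stated for sets of homotopy
classes of maps; since `p`-perfect monoids are closed under the cotensors `N ↦ N ^ K` with
simplicial sets, it is equivalent to the one for mapping spaces. -/
structure IsPPerfection (p : ℕ) {M L : GammaSpace} (η : toHo.obj M ⟶ toHo.obj L) : Prop where
  perfect : IsPPerfect p L
  existsUnique_desc (N : GammaSpace) (hN : IsPPerfect p N) (g : toHo.obj M ⟶ toHo.obj N) :
    ∃! h : toHo.obj L ⟶ toHo.obj N, η ≫ h = g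

/-- A strict map of Γ-spaces `M ⟶ M` that represents the Frobenius map of `M`. Up to equivalence, the
telescope below does not depend on which representative is chosen. -/
structure StrictFrobenius (p : ℕ) (M : GammaSpace) (hM : IsSpecial M) where
  map : M ⟶ M
  isFrobenius : toHo.map map = frobenius p M hM

/-- The `p`-telescope `colim (M → M → M → ⋯)`, all transition maps being `p`. Sequential
colimits of simplicial sets are homotopy colimits, and sequential homotopy colimits of commutative
monoids are computed levelwise, so this is the (homotopy) colimit in commutative monoids. -/
noncomputable def telescope {p : ℕ} {M : GammaSpace} {hM : IsSpecial M}
    (φ : StrictFrobenius p M hM) : GammaSpace :=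
  colimit (Functor.ofSequence fun _ : ℕ => φ.map)

/-- The canonical map from `M`, at the first stage, to its `p`-telescope. -/
noncomputable def toTelescope {p : ℕ} {M : GammaSpace} {hM : IsSpecial M}
    (φ : StrictFrobenius p M hM) : M ⟶ telescope φ :=
  colimit.ι (Functor.ofSequence fun _ : ℕ => φ.map) 0

/-- Homotopic maps of Γ-spaces agree in the homotopy category. -/
lemma toHo_map_eq {X Y : GammaSpace} {f g : X ⟶ Y}
    (h : X ⋙ MonoidalCategory.tensorRight walkingNerve ⟶ Y)
    (h₀ : ∀ I, walkingEnd .zero _ ≫ h.app I = f.app I)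
    (h₁ : ∀ I, walkingEnd .one _ ≫ h.app I = g.app I) : toHo.map f = toHo.map g := by
  let π : X ⋙ MonoidalCategory.tensorRight walkingNerve ⟶ X :=
    { app := fun I => SemiCartesianMonoidalCategory.fst _ _, naturality := by intros; rfl }
  let i (b : WalkingIso) : X ⟶ X ⋙ MonoidalCategory.tensorRight walkingNerve :=
    { app := fun I => walkingEnd b _, naturality := by intros; rfl }
  have : IsIso (toHo.map π) :=
    Localization.inverts toHo levelwiseWeakEq π fun I => weakEq_fst (X.obj I)
  have hi (b : WalkingIso) : i b ≫ π = 𝟙 X := rfl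
  have e : toHo.map (i .zero) = toHo.map (i .one) := by
    rw [← cancel_mono (toHo.map π), ← Functor.map_comp, ← Functor.map_comp, hi, hi]
  have hf : i .zero ≫ h = f := by ext1; funext I; exact h₀ I
  have hg : i .one ≫ h = g := by ext1; funext I; exact h₁ I
  rw [← hf, ← hg, Functor.map_comp, Functor.map_comp, e]

/-! ### The groupoid of finite sets -/

/-- A finite set `{0, …, card - 1}` with a map `lab` to `I₊`. The elements over the base point are
to be discarded, so this is a model for finite sets over `I` (equivalently, for families of
finite sets indexed by `I`) on which pushforward along pointed maps is strictly functorial. -/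
structure LabeledSet (I : FinStar) where
  card : ℕ
  lab : Fin card → Option I.carrier

namespace LabeledSet

variable {I J : FinStar}

/-- The finite set over `I` that a labelled set stands for. -/
abbrev supp (a : LabeledSet I) : Type := {x : Fin a.card // a.lab x ≠ none}

/-- Bijections over `I`. -/
@[ext]
structure Hom (a b : LabeledSet I) where
  equiv : a.supp ≃ b.supp
  lab_equiv : ∀ x, b.lab (equiv x).1 = a.lab x.1

instance : Groupoid (LabeledSet I) where
  Hom := Hom
  id a := ⟨Equiv.refl _, fun _ => rfl⟩
  comp e f := ⟨e.equiv.trans f.equiv, fun x => (f.lab_equiv _).trans (e.lab_equiv x)⟩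
  inv e := ⟨e.equiv.symm, fun x => by
    rw [← e.lab_equiv, Equiv.apply_symm_apply]⟩
  id_comp _ := rfl
  comp_id _ := rfl
  assoc _ _ _ := rfl
  inv_comp e := Hom.ext (Equiv.symm_trans_self _)
  comp_inv e := Hom.ext (Equiv.self_trans_symm _)

lemma hom_ext {a b : LabeledSet I} {e f : a ⟶ b} (h : ∀ x, (e.equiv x).1 = (f.equiv x).1) : e = f :=
  Hom.ext (Equiv.ext fun x => Subtype.ext (h x))

/-- Pushforward along a pointed map `I₊ → J₊`: the fibre over `j` of the result is the disjoint
union of the fibres over all `i` that are sent to `j`. -/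
def push (f : I ⟶ J) : LabeledSet I ⥤ LabeledSet J where
  obj a := ⟨a.card, fun x => f.toFun (a.lab x)⟩
  map {a b} e :=
    have ne {a : LabeledSet I} {x : Fin a.card} (h : f.toFun (a.lab x) ≠ none) : a.lab x ≠ none :=
      fun h' => h (by rw [h', f.map_none])
    { equiv :=
        { toFun := fun x => ⟨(e.equiv ⟨x.1, ne x.2⟩).1, fun h => x.2 ((congrArg f.toFun (e.lab_equiv ⟨x.1, ne x.2⟩)).symm.trans h)⟩
          invFun := fun y => ⟨(e.equiv.symm ⟨y.1, ne y.2⟩).1, by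
            have := e.lab_equiv (e.equiv.symm ⟨y.1, ne y.2⟩)
            rw [Equiv.apply_symm_apply] at this
            exact fun h => y.2 ((congrArg f.toFun this).trans h)⟩
          left_inv := fun x => by ext; simp
          right_inv := fun x => by ext; simp }
      lab_equiv := fun x => congrArg f.toFun (e.lab_equiv ⟨x.1, ne x.2⟩) }
  map_id _ := rfl
  map_comp _ _ := rfl

/-- A bijection of the underlying finite sets that respects labels. -/
noncomputable def homMk {a b : LabeledSet I} (f : a.supp → b.supp) (hf : Function.Bijective f)
    (h : ∀ x, b.lab (f x).1 = a.lab x.1) : a ⟶ b :=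
  ⟨Equiv.ofBijective f hf, h⟩

/-- The functor that sends `A → I₊` to the family of its fibres over the elements of `I`. -/
noncomputable def fibres (I : FinStar) : LabeledSet I ⥤ (I.carrier → LabeledSet .pt) :=
  Functor.pi' fun i => push (FinStar.proj i)

lemma proj_ne_none_iff {i : I.carrier} {x : Option I.carrier} :
    (FinStar.proj i).toFun x ≠ none ↔ x = some i := by
  refine ⟨fun h => by_contra fun h' => h (FinStar.proj_of_ne h'), ?_⟩
  rintro rfl
  rw [FinStar.proj_some_self]
  exact Option.some_ne_none _

instance : (fibres I).Faithful where
  map_injective {a b e f} h := by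
    apply hom_ext
    rintro ⟨x, hx⟩
    obtain ⟨i, hi⟩ := Option.ne_none_iff_exists'.1 hx
    have := congrFun h i
    have h2 := congrArg (fun g : (push (FinStar.proj i)).obj a ⟶ (push (FinStar.proj i)).obj b =>
      (g.equiv ⟨x, proj_ne_none_iff.2 hi⟩).1) this
    exact h2

instance : (fibres I).Full where
  map_surjective {a b} e := by
    have hlab (x : a.supp) : ∃ i, a.lab x.1 = some i := Option.ne_none_iff_exists'.1 x.2
    choose l hl using hlab
    let e' (i : I.carrier) : (push (FinStar.proj i)).obj a ⟶ (push (FinStar.proj i)).obj b := e i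
    have hb (i : I.carrier) (x) : b.lab ((e' i).equiv x).1 = some i :=
      proj_ne_none_iff.1 ((e' i).equiv x).2
    let f (x : a.supp) : b.supp :=
      ⟨((e' (l x)).equiv ⟨x.1, proj_ne_none_iff.2 (hl x)⟩).1, by
        rw [hb]; exact Option.some_ne_none _⟩
    have hf (x : a.supp) (i : I.carrier) (hi : a.lab x.1 = some i) :
        (f x).1 = ((e' i).equiv ⟨x.1, proj_ne_none_iff.2 hi⟩).1 := by
      obtain rfl : l x = i := Option.some.inj ((hl x).symm.trans hi)
      rfl
    refine ⟨homMk f ⟨fun x y hxy => ?_, fun y => ?_⟩ fun x => ?_, ?_⟩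
    · have hx : b.lab (f x).1 = some (l x) := hb _ _
      have hy : b.lab (f y).1 = some (l y) := hb _ _
      have hlxy : l y = l x := by
        rw [hxy] at hx
        exact Option.some.inj (hy.symm.trans hx)
      have h1 := hf x (l x) (hl x)
      have h2 := hf y (l x) (hlxy ▸ hl y)
      rw [hxy, h2] at h1
      have := (e' (l x)).equiv.injective (Subtype.ext h1)
      exact Subtype.ext (congrArg Subtype.val this).symm
    · obtain ⟨i, hi⟩ := Option.ne_none_iff_exists'.1 y.2
      let y' : ((push (FinStar.proj i)).obj b).supp := ⟨y.1, proj_ne_none_iff.2 hi⟩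
      let x' := (e' i).equiv.symm y'
      have hx' : a.lab x'.1 = some i := proj_ne_none_iff.1 x'.2
      refine ⟨⟨x'.1, by rw [hx']; exact Option.some_ne_none _⟩, Subtype.ext ?_⟩
      rw [hf _ i hx']
      exact congrArg Subtype.val ((e' i).equiv.apply_symm_apply y')
    · exact (hb _ _).trans (hl x).symm
    · funext i
      apply hom_ext
      rintro ⟨x, hx⟩
      have hi := proj_ne_none_iff.1 hx
      exact hf ⟨x, by rw [hi]; exact Option.some_ne_none _⟩ i hi

instance : (fibres I).EssSurj where
  mem_essImage c := by
    let T : Type := Σ i : I.carrier, (c i).supp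
    let ε : T ≃ Fin (Nat.card T) := Finite.equivFin T
    let a : LabeledSet I := ⟨Nat.card T, fun z => some (ε.symm z).1⟩
    have ha (i : I.carrier) (y : (c i).supp) : a.lab (ε ⟨i, y⟩) = some i := by simp [a]
    let f (i : I.carrier) (y : (c i).supp) : ((push (FinStar.proj i)).obj a).supp :=
      ⟨ε ⟨i, y⟩, proj_ne_none_iff.2 (ha i y)⟩
    have hf (i : I.carrier) : Function.Bijective (f i) := by
      refine ⟨fun y y' h => ?_, fun z => ?_⟩
      · have := ε.injective (congrArg Subtype.val h)
        exact eq_of_heq (Sigma.mk.inj_iff.1 this).2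
      · obtain ⟨⟨j, y⟩, hy⟩ := ε.surjective z.1
        have hz : a.lab z.1 = some i := proj_ne_none_iff.1 z.2
        rw [← hy, ha] at hz
        obtain rfl : i = j := (Option.some.inj hz).symm
        exact ⟨y, Subtype.ext hy⟩
    have hl (i : I.carrier) (y : (c i).supp) :
        (FinStar.proj i).toFun (a.lab (f i y).1) = (c i).lab y.1 := by
      obtain ⟨u, hu⟩ := Option.ne_none_iff_exists'.1 y.2
      rw [hu, ha, FinStar.proj_some_self]
      rfl
    let φ (i : I.carrier) : c i ⟶ (push (FinStar.proj i)).obj a := homMk (f i) (hf i) (hl i)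
    exact ⟨a, ⟨{ hom := fun i => Groupoid.inv (φ i), inv := φ,
                 hom_inv_id := by funext i; exact Groupoid.inv_comp (φ i)
                 inv_hom_id := by funext i; exact Groupoid.comp_inv (φ i) }⟩⟩

instance : (fibres I).IsEquivalence where

/-- The functor that sends a labelled set `A` to `A × {1, …, p}`, where the `p` copies
of `A` carry separate labels. -/
def copies (p : ℕ) (I : FinStar) : LabeledSet I ⥤ LabeledSet ((FinStar.smash p).obj I) where
  obj a := ⟨a.card * p, fun z => (a.lab (finProdFinEquiv.symm z).1).map
    fun x => ((finProdFinEquiv.symm z).2, x)⟩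
  map {a b} e :=
    { equiv :=
        { toFun := fun z => ⟨finProdFinEquiv ((e.equiv ⟨(finProdFinEquiv.symm z.1).1,
              fun h => z.2 (by simp only [h]; rfl)⟩).1, (finProdFinEquiv.symm z.1).2), by
            have := (e.equiv ⟨(finProdFinEquiv.symm z.1).1,
              fun h => z.2 (by simp only [h]; rfl)⟩).2
            intro h
            simp only [Equiv.symm_apply_apply] at h
            exact this (Option.map_eq_none_iff.1 h)⟩
          invFun := fun z => ⟨finProdFinEquiv ((e.equiv.symm ⟨(finProdFinEquiv.symm z.1).1,
              fun h => z.2 (by simp only [h]; rfl)⟩).1, (finProdFinEquiv.symm z.1).2), by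
            have := (e.equiv.symm ⟨(finProdFinEquiv.symm z.1).1,
              fun h => z.2 (by simp only [h]; rfl)⟩).2
            intro h
            simp only [Equiv.symm_apply_apply] at h
            exact this (Option.map_eq_none_iff.1 h)⟩
          left_inv := fun z => by
            ext1
            simp only [Equiv.symm_apply_apply, Subtype.coe_eta]
            exact finProdFinEquiv.apply_symm_apply z.1
          right_inv := fun z => by
            ext1
            simp only [Equiv.symm_apply_apply, Subtype.coe_eta, Equiv.apply_symm_apply]
            exact finProdFinEquiv.apply_symm_apply z.1 }
      lab_equiv := fun z => by
        have := e.lab_equiv ⟨(finProdFinEquiv.symm z.1).1,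
              fun h => z.2 (by simp only [h]; rfl)⟩
        simp only [Equiv.coe_fn_mk, Equiv.symm_apply_apply, this] }
  map_id a := by
    apply hom_ext
    intro z
    exact finProdFinEquiv.apply_symm_apply z.1
  map_comp {a b c} e f := by
    apply hom_ext
    intro z
    have key := finProdFinEquiv.symm_apply_apply ((e.equiv ⟨(finProdFinEquiv.symm z.1).1,
      fun h => z.2 (by simp only [h]; rfl)⟩).1, (finProdFinEquiv.symm z.1).2)
    refine congrArg finProdFinEquiv (Prod.ext ?_ ?_)
    · exact congrArg (fun y : b.supp => (f.equiv y).1) (Subtype.ext (congrArg Prod.fst key).symm)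
    · exact (congrArg Prod.snd key).symm

lemma hom_heq {a a' b b' : LabeledSet I} (ha : a = a') (hb : b = b') (e : a ⟶ b) (e' : a' ⟶ b')
    (h : ∀ (x : a.supp) (x' : a'.supp), x.1.val = x'.1.val →
      (e.equiv x).1.val = (e'.equiv x').1.val) : HEq e e' := by
  subst ha hb
  exact heq_of_eq (hom_ext fun x => Fin.ext (h x x rfl))

end LabeledSet

/-- The groupoid of finite sets under disjoint union, as a Γ-space: `I₊` is sent to (the nerve of)
the groupoid of finite sets over `I`. -/
def finGamma : GammaSpace where
  obj I := nerve (LabeledSet I)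
  map f := nerveMap (LabeledSet.push f)
  map_id _ := rfl
  map_comp _ _ := rfl

/-- The groupoid of finite sets is a commutative monoid. -/
lemma isSpecial_finGamma : IsSpecial finGamma := by
  intro I
  have : segalMap finGamma I = nerveMap (LabeledSet.fibres I) ≫ (nervePow _ _).hom := rfl
  rw [this]
  exact weakEq_comp (weakEq_nerveMap _) (weakEq_of_iso _)

/-- The functors `copies`, as a map of Γ-spaces. -/
def copiesMap (p : ℕ) : finGamma ⟶ FinStar.smash p ⋙ finGamma where
  app I := nerveMap (LabeledSet.copies p I)
  naturality I J f := by
    have hobj (a : LabeledSet I) : (LabeledSet.push f ⋙ LabeledSet.copies p J).obj a =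
        (LabeledSet.copies p I ⋙ LabeledSet.push ((FinStar.smash p).map f)).obj a := by
      refine congrArg (LabeledSet.mk (a.card * p)) (funext fun z => ?_)
      change (f.toFun (a.lab (finProdFinEquiv.symm z).1)).map _ =
        ((FinStar.smash p).map f).toFun ((a.lab (finProdFinEquiv.symm z).1).map _)
      cases h : a.lab (finProdFinEquiv.symm z).1
      · rw [f.map_none]
        exact ((FinStar.smash p).map f).map_none.symm
      · rfl
    have : LabeledSet.push f ⋙ LabeledSet.copies p J =
        LabeledSet.copies p I ⋙ LabeledSet.push ((FinStar.smash p).map f) := by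
      refine CategoryTheory.Functor.hext hobj fun a b e => LabeledSet.hom_heq (hobj a) (hobj b) _ _ ?_
      rintro ⟨x, hx⟩ ⟨x', hx'⟩ h
      obtain rfl : x = x' := Fin.ext h
      rfl
    exact congrArg nerveMap this

lemma copies_lab (p : ℕ) (k : Fin p) {I : FinStar} (a : LabeledSet I) (z : Fin (a.card * p)) :
    ((LabeledSet.push ((FinStar.smashProj p k).app I)).obj ((LabeledSet.copies p I).obj a)).lab z =
      if (finProdFinEquiv.symm z).2 = k then a.lab (finProdFinEquiv.symm z).1 else none := by
  change ((a.lab (finProdFinEquiv.symm z).1).map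
    fun x => ((finProdFinEquiv.symm z).2, x)).bind (fun y => if y.1 = k then some y.2 else none) = _
  cases a.lab (finProdFinEquiv.symm z).1 <;> simp

/-- The natural isomorphism between `A` and the `k`-th copy of `A` in `A × {1, …, p}`. -/
noncomputable def copyIso (p : ℕ) (k : Fin p) (I : FinStar) : 𝟭 (LabeledSet I) ≅
    LabeledSet.copies p I ⋙ LabeledSet.push ((FinStar.smashProj p k).app I) :=
  have hlab (a : LabeledSet I) (x : Fin a.card) :
      ((LabeledSet.push ((FinStar.smashProj p k).app I)).obj ((LabeledSet.copies p I).obj a)).lab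
        (finProdFinEquiv (x, k)) = a.lab x := by
    rw [copies_lab, Equiv.symm_apply_apply, if_pos rfl]
  have hk (a : LabeledSet I) (z : Fin (a.card * p))
      (hz : ((LabeledSet.push ((FinStar.smashProj p k).app I)).obj
        ((LabeledSet.copies p I).obj a)).lab z ≠ none) :
      (finProdFinEquiv.symm z).2 = k ∧ a.lab (finProdFinEquiv.symm z).1 ≠ none := by
    rw [copies_lab] at hz
    by_cases h : (finProdFinEquiv.symm z).2 = k
    · rw [if_pos h] at hz
      exact ⟨h, hz⟩
    · exact (hz (if_neg h)).elim
  have hz {n : ℕ} (z : Fin (n * p)) (h : (finProdFinEquiv.symm z).2 = k) :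
      finProdFinEquiv ((finProdFinEquiv.symm z).1, k) = z := by
    rw [← h]
    exact finProdFinEquiv.apply_symm_apply z
  NatIso.ofComponents (fun a => (Groupoid.isoEquivHom _ _).symm
    { equiv :=
        { toFun := fun x => ⟨finProdFinEquiv (x.1, k), fun h => x.2 ((hlab a x.1).symm.trans h)⟩
          invFun := fun z => ⟨(finProdFinEquiv.symm z.1).1, (hk a z.1 z.2).2⟩
          left_inv := fun x => Subtype.ext
            (congrArg Prod.fst (finProdFinEquiv.symm_apply_apply (x.1, k)))
          right_inv := fun z => Subtype.ext (hz z.1 (hk a z.1 z.2).1) }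
      lab_equiv := fun x => hlab a x.1 })
    (by
      intro a b e
      apply LabeledSet.hom_ext
      intro x
      refine congrArg finProdFinEquiv (Prod.ext ?_ ?_)
      · exact congrArg (fun y : a.supp => (e.equiv y).1) (Subtype.ext
          (congrArg Prod.fst (finProdFinEquiv.symm_apply_apply (x.1, k))).symm)
      · exact (congrArg Prod.snd (finProdFinEquiv.symm_apply_apply (x.1, k))).symm)

/-- `copyIso` as a functor on a product. -/
noncomputable def copyFunctor (p : ℕ) (k : Fin p) (I : FinStar) :
    WalkingIso.{0} × LabeledSet I ⥤ LabeledSet I :=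
  Functor.uncurry.obj (WalkingIso.fromIso (copyIso p k I))

lemma copyFunctor_naturality (p : ℕ) (k : Fin p) {I J : FinStar} (f : I ⟶ J) :
    Functor.prod (𝟭 _) (LabeledSet.push f) ⋙ copyFunctor p k J =
      copyFunctor p k I ⋙ LabeledSet.push f := by
  have key (a : LabeledSet I) (z : Fin (a.card * p)) :
      (if (finProdFinEquiv.symm z).2 = k then f.toFun (a.lab (finProdFinEquiv.symm z).1) else none) =
        f.toFun (if (finProdFinEquiv.symm z).2 = k then a.lab (finProdFinEquiv.symm z).1 else none) := by
    by_cases h : (finProdFinEquiv.symm z).2 = k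
    · rw [if_pos h, if_pos h]
    · rw [if_neg h, if_neg h, f.map_none]
  have hobj (x : WalkingIso.{0} × LabeledSet I) :
      (Functor.prod (𝟭 _) (LabeledSet.push f) ⋙ copyFunctor p k J).obj x =
        (copyFunctor p k I ⋙ LabeledSet.push f).obj x := by
    obtain ⟨b, a⟩ := x
    induction b with
    | zero => rfl
    | one =>
      refine congrArg (LabeledSet.mk (a.card * p)) (funext fun z => ?_)
      refine (copies_lab p k ((LabeledSet.push f).obj a) z).trans ?_
      refine Eq.trans ?_ (congrArg f.toFun (copies_lab p k a z)).symm
      exact key a z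
  refine CategoryTheory.Functor.hext hobj ?_
  rintro ⟨b, a⟩ ⟨b', a'⟩ ⟨u, e⟩
  refine LabeledSet.hom_heq (hobj _) (hobj _) _ _ ?_
  induction b <;> induction b' <;>
  · rintro ⟨x, hx⟩ ⟨x', hx'⟩ h
    obtain rfl : x = x' := Fin.ext h
    rfl

/-- `copyIso` as a homotopy of maps of Γ-spaces. -/
noncomputable def copyCyl (p : ℕ) (k : Fin p) :
    finGamma ⋙ MonoidalCategory.tensorRight walkingNerve ⟶ finGamma where
  app I := nerveCyl (copyFunctor p k I)
  naturality I J f := by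
    ext n s
    exact congrArg (fun F => Functor.prod' s.2 s.1 ⋙ F) (copyFunctor_naturality p k f)

lemma copiesMap_smashSegal (p : ℕ) : toHo.map (copiesMap p) ≫ toHo.map (smashSegal p finGamma) =
    toHo.map (diagonal p finGamma) := by
  rw [← Functor.map_comp]
  symm
  refine toHo_map_eq
    { app := fun I =>
        { app := fun n => ↾fun x k => ((copyCyl p k).app I).app n x
          naturality := by intros; rfl }
      naturality := fun I J f => ?_ } (fun I => ?_) (fun I => ?_)
  · ext n x
    funext k
    exact congrArg (fun g => g.app n x) ((copyCyl p k).naturality f)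
  · ext n x
    funext k
    have := (walkingEnd_nerveCyl .zero (copyFunctor p k I)).trans
      (congrArg nerveMap (ends_uncurry₀ (copyIso p k I)))
    exact congrArg (fun g => g.app n x) this
  · ext n x
    funext k
    have := (walkingEnd_nerveCyl .one (copyFunctor p k I)).trans
      (congrArg nerveMap (ends_uncurry₁ (copyIso p k I)))
    exact congrArg (fun g => g.app n x) this

/-- The functor `A ↦ A × {1, …, p}` is a strict map of Γ-spaces that represents the Frobenius map of
the groupoid of finite sets. -/
noncomputable def finFrobenius (p : ℕ) : StrictFrobenius p finGamma isSpecial_finGamma where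
  map := copiesMap p ≫ foldMap p finGamma
  isFrobenius := by
    rw [frobenius, ← copiesMap_smashSegal, Functor.map_comp, Category.assoc]
    congr 1
    exact ((Localization.isoOfHom toHo levelwiseWeakEq (smashSegal p finGamma)
      (smashSegal_weakEq p isSpecial_finGamma)).hom_inv_id_assoc _).symm


/-! ### Fundamental groups -/

/-- The fundamental group `π₁(X, x)` of a simplicial set: the automorphism group of `x` in the
fundamental groupoid of `X`, which is obtained from the homotopy category of `X` (generated by the
edges of `X`, with one relation for each triangle) by inverting all morphisms. -/
abbrev π₁ (X : SSet.{0}) (x : X _⦋0⦌) : Type :=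
  Aut (FreeGroupoid.mk ((SSet.hoFunctor.obj.equiv X).symm x))

/-- The underlying space of a Γ-space. -/
abbrev underlying (X : GammaSpace) : SSet.{0} := X.obj .pt

/-- The one-element set, as a point of the underlying space of `finGamma`. -/
def onePoint : (underlying finGamma) _⦋0⦌ :=
  nerveEquiv.symm (⟨1, fun _ => some ()⟩ : LabeledSet .pt)

/-- The underlying groupoid of `finGamma` is equivalent to the groupoid of finite sets. -/
noncomputable def LabeledSet.toCore : LabeledSet .pt ⥤ Core FintypeCat.{0} where
  obj a := ⟨letI := Fintype.ofFinite a.supp; FintypeCat.of a.supp⟩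
  map {a b} e := ⟨letI := Fintype.ofFinite a.supp; letI := Fintype.ofFinite b.supp;
    FintypeCat.equivEquivIso e.equiv⟩

instance : LabeledSet.toCore.IsEquivalence where
  faithful := ⟨by
    intro a b e f h
    apply LabeledSet.hom_ext
    intro x
    have := congrArg (fun g => (g.iso.hom : _ → _) x) h
    exact congrArg Subtype.val this⟩
  full := ⟨by
    intro a b g
    refine ⟨⟨FintypeCat.equivEquivIso.symm g.iso, fun x => ?_⟩, ?_⟩
    · obtain ⟨u, hu⟩ := Option.ne_none_iff_exists'.1 x.2
      obtain ⟨v, hv⟩ := Option.ne_none_iff_exists'.1 (FintypeCat.equivEquivIso.symm g.iso x).2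
      rw [hu]
      exact hv
    · apply CoreHom.ext
      exact FintypeCat.equivEquivIso.apply_symm_apply g.iso⟩
  essSurj := ⟨fun X => by
    let a : LabeledSet .pt := ⟨Nat.card X.of, fun _ => some ()⟩
    let := Fintype.ofFinite a.supp
    have ε : a.supp ≃ X.of :=
      (Equiv.subtypeUnivEquiv fun x => Option.some_ne_none ()).trans (Finite.equivFin X.of).symm
    exact ⟨a, ⟨Core.isoMk (FintypeCat.equivEquivIso ε)⟩⟩⟩
end EInfty

open CategoryTheory Simplicial EInfty

/-! Multiplication by `p` on a commutative monoid sends `x` to the sum of `p` copies of `x`. If it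
is an equivalence, it is full on fundamental groupoids, so every automorphism of `p·x` is, up to
conjugation, a sum of `p` copies of a single automorphism of `x`. Such a sum commutes with every
permutation of the summands, so the image of `Σ_p` in `Aut(p·x)` is central (`permutation_central`).
In the telescope take `x` to be the image of the one-element set. A nontrivial permutation of the
`p` summands becomes, one stage later, a nontrivial permutation of at least four points, and
symmetric groups on three or more points have trivial centre. All stages embed faithfully in the
telescope, because `A ↦ A × {1, …, p}` is faithful, so the permutation is not central there
(`exists_not_comm_stageFunctor`). This contradiction is `not_isPPerfect_telescope`.

The Frobenius map is natural in the homotopy category, so being `p`-perfect is invariant under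
isomorphism between special Γ-spaces, and the comparison with the `p`-perfection cannot be an
isomorphism. For the fundamental group, the image of `1` is also represented by a set of `p`
elements at stage one and of `p²` elements at stage two. The automorphism groups of both embed in
`π₁`; the first contains `Σ_p` and the second is not abelian.

The homotopy theory needed for this reduces to groupoids. A sequential colimit of nerves of
groupoids is strictly Segal with inverses, hence is the nerve of its groupoid of edges `EdgeCat`.
Weak equivalences between such simplicial sets are exactly the maps that are equivalences on edge
groupoids; here it matters that nerves of groupoids are Kan. The same facts show that an arbitrary
strict representative of the Frobenius map is, on underlying groupoids, isomorphic to `A ↦ A × {1,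
…, p}` (`exists_functor_iso_times`). -/

namespace EInfty

open CategoryTheory Limits Simplicial MonoidalCategory

/-! ### Homotopies between nerves and natural isomorphisms -/

section Nerve

variable {C D : Type} [SmallCategory C] [SmallCategory D]

lemma nerveMap_surjective (f : nerve C ⟶ nerve D) : ∃ F : C ⥤ D, nerveMap F = f := by
  obtain ⟨F, hF⟩ := nerveFunctor.map_surjective (X := Cat.of C) (Y := Cat.of D) f
  exact ⟨F.toFunctor, hF⟩

lemma nerveMap_injective {F G : C ⥤ D} (h : nerveMap F = nerveMap G) : F = G := by
  have := nerveFunctor.map_injective (X := Cat.of C) (Y := Cat.of D)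
    (a₁ := F.toCatHom) (a₂ := G.toCatHom) h
  exact congrArg Cat.Hom.toFunctor this

/-- The nerve of `C × [1]` maps to the cylinder on the nerve of `C`. -/
def nerveProdToCylinder (C : Type) [SmallCategory C] : nerve (C × Fin 2) ⟶ nerve C ⊗ Δ[1] where
  app n := ↾fun s => (s ⋙ CategoryTheory.Prod.fst C (Fin 2), SSet.stdSimplex.objEquiv.symm
    (SimplexCategory.Hom.mk ⟨(s ⋙ CategoryTheory.Prod.snd C (Fin 2)).obj, fun _ _ h =>
      leOfHom ((s ⋙ CategoryTheory.Prod.snd C (Fin 2)).map (homOfLE h))⟩))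
  naturality := by intros; rfl

/-- Restricted along the nerve of `C × [1]`, a homotopy becomes a map of nerves, hence a functor on
`C × [1]`; the edge of `[1]` then gives the transformation. -/
lemma natTrans_of_homotopy {F G : C ⥤ D} (H : SSet.Homotopy (nerveMap F) (nerveMap G)) :
    Nonempty (F ⟶ G) := by
  obtain ⟨K, hK⟩ := nerveMap_surjective (nerveProdToCylinder C ≫ H.h)
  let i (b : Fin 2) : C ⥤ C × Fin 2 := Functor.prod' (𝟭 C) ((Functor.const C).obj b)
  have h₀ : F = i 0 ⋙ K := nerveMap_injective <|
    H.h₀.symm.trans (congrArg (nerveMap (i 0) ≫ ·) hK.symm)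
  have h₁ : G = i 1 ⋙ K := nerveMap_injective <|
    H.h₁.symm.trans (congrArg (nerveMap (i 1) ≫ ·) hK.symm)
  let τ : i 0 ⟶ i 1 := { app := fun x => (𝟙 x, homOfLE (Fin.zero_le 1)) }
  exact ⟨eqToHom h₀ ≫ Functor.whiskerRight τ K ≫ eqToHom h₁.symm⟩

lemma iso_of_hoEq [IsGroupoid D] {F G : C ⥤ D} (H : HoEq (nerveMap F) (nerveMap G)) :
    Nonempty (F ≅ G) := by
  -- The intermediate maps of a zigzag of homotopies are arbitrary maps of nerves, so the induction
  -- runs over maps; fullness of the nerve turns each of them back into a functor.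
  suffices ∀ f g : nerve C ⟶ nerve D, HoEq f g → ∀ F G : C ⥤ D, nerveMap F = f →
      nerveMap G = g → Nonempty (F ≅ G) from this _ _ H _ _ rfl rfl
  intro f g H
  induction H with
  | rel f g h =>
    rintro F G rfl rfl
    obtain ⟨h⟩ := h
    obtain ⟨τ⟩ := natTrans_of_homotopy h
    exact ⟨NatIso.ofComponents (fun x => asIso (τ.app x)) (by simp)⟩
  | refl f =>
    rintro F G rfl h
    exact ⟨eqToIso (nerveMap_injective h.symm)⟩
  | symm f g _ ih =>
    intro F G hF hG
    exact (ih G F hG hF).map Iso.symm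
  | trans f g h _ _ ih ih' =>
    intro F G hF hG
    obtain ⟨E, hE⟩ := nerveMap_surjective g
    obtain ⟨a⟩ := ih F E hF hE
    obtain ⟨b⟩ := ih' E G hE hG
    exact ⟨a ≪≫ b⟩

end Nerve

lemma app_map {X Y : SSet.{0}} (f : X ⟶ Y) {m n : SimplexCategoryᵒᵖ} (θ : m ⟶ n) (x : X.obj m) :
    f.app n (X.map θ x) = Y.map θ (f.app m x) :=
  NatTrans.naturality_apply f θ x

lemma app_δ {X Y : SSet.{0}} (f : X ⟶ Y) {n : ℕ} (i : Fin (n + 2)) (x : X _⦋n + 1⦌) :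
    f.app _ (X.δ i x) = Y.δ i (f.app _ x) :=
  NatTrans.naturality_apply f _ x

lemma app_σ {X Y : SSet.{0}} (f : X ⟶ Y) {n : ℕ} (i : Fin (n + 1)) (x : X _⦋n⦌) :
    f.app _ (X.σ i x) = Y.σ i (f.app _ x) :=
  NatTrans.naturality_apply f _ x

lemma δ_σ_zero (X : SSet.{0}) (i : Fin 2) (x : X _⦋0⦌) : X.δ i (X.σ 0 x) = x := by
  fin_cases i
  · exact congrArg (fun q => q x) (X.δ_comp_σ_self (i := (0 : Fin 1)))
  · exact congrArg (fun q => q x) (X.δ_comp_σ_succ (i := (0 : Fin 1)))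

/-- In a strictly Segal target a simplex is determined by its spine, and vertices are recovered as
faces of degenerate edges. -/
lemma hom_ext_of_edges {X Y : SSet.{0}} [Y.IsStrictSegal] {f g : X ⟶ Y}
    (h : ∀ e : X _⦋1⦌, f.app _ e = g.app _ e) : f = g := by
  have h₀ (x : X _⦋0⦌) : f.app _ x = g.app _ x := by
    have := congrArg (Y.δ 0) (h (X.σ 0 x))
    rwa [← app_δ, ← app_δ, δ_σ_zero] at this
  apply NatTrans.ext
  funext n
  ext s
  induction n using Opposite.rec with | op n
  induction n using SimplexCategory.rec with | _ n
  apply (SSet.IsStrictSegal.segal (X := Y) n).injective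
  refine SSet.Path.ext (funext fun i => ?_) (funext fun i => ?_)
  · exact (app_map f _ s).symm.trans ((h₀ _).trans (app_map g _ s))
  · exact (app_map f _ s).symm.trans ((h _).trans (app_map g _ s))

/-! ### Nerves of groupoids are Kan complexes -/

section Kan

open SSet Opposite

variable {G : Type} [SmallCategory G] {n : ℕ} {i : Fin (n + 3)}

namespace hornStar

/-- A vertex of a horn of dimension at least two. -/
def vertex (i j : Fin (n + 3)) : (Λ[n + 2, i] : SSet.{0}) _⦋0⦌ :=
  ⟨stdSimplex.objMk (OrderHom.const _ j), by rw [horn_obj_zero]; trivial⟩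

lemma mem_horn {d : ℕ} (s : (Δ[n + 2] : SSet.{0}) _⦋d⦌) (k : Fin (n + 3)) (hi : i ≠ k)
    (h : ∀ a, s a ≠ k) : s ∈ (horn (n + 2) i).obj (op ⦋d⦌) := by
  rw [mem_horn_iff_notMem_range]
  exact ⟨k, hi.symm, fun ⟨a, ha⟩ => h a ha⟩

/-- An edge of a horn, between vertices `a ≤ b` that do not exhaust the complement of `i`. -/
def edge (a b : Fin (n + 3)) (hab : a ≤ b) (h : ∃ k, i ≠ k ∧ a ≠ k ∧ b ≠ k) :
    Edge (vertex i a) (vertex i b) :=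
  .mk ⟨stdSimplex.edge _ a b hab, by
    obtain ⟨k, hi, ha, hb⟩ := h
    refine mem_horn _ k hi fun x => ?_
    fin_cases x
    · exact ha
    · exact hb⟩
    (Subtype.ext (SSet.stdSimplex.ext _ _ fun x => by fin_cases x; rfl))
    (Subtype.ext (SSet.stdSimplex.ext _ _ fun x => by fin_cases x; rfl))

/-- A triangle of a horn. -/
def compStruct (a b c : Fin (n + 3)) (hab : a ≤ b) (hbc : b ≤ c)
    (h : ∃ k, i ≠ k ∧ a ≠ k ∧ b ≠ k ∧ c ≠ k) :
    Edge.CompStruct (edge (i := i) a b hab (h.imp (by tauto))) (edge b c hbc (h.imp (by tauto)))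
      (edge a c (hab.trans hbc) (h.imp (by tauto))) :=
  .mk ⟨stdSimplex.triangle a b c hab hbc, by
    obtain ⟨k, hi, ha, hb, hc⟩ := h
    refine mem_horn _ k hi fun x => ?_
    fin_cases x
    · exact ha
    · exact hb
    · exact hc⟩
    (Subtype.ext (SSet.stdSimplex.ext _ _ fun x => by fin_cases x <;> rfl))
    (Subtype.ext (SSet.stdSimplex.ext _ _ fun x => by fin_cases x <;> rfl))
    (Subtype.ext (SSet.stdSimplex.ext _ _ fun x => by fin_cases x <;> rfl))

variable (t : (Λ[n + 2, i] : SSet.{0}) ⟶ nerve G)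

/-- The image of a vertex of the horn. -/
def obj (a : Fin (n + 3)) : G := nerveEquiv (t.app _ (vertex i a))

/-- The image of an edge of the horn. -/
def map (a b : Fin (n + 3)) (hab : a ≤ b) (h : ∃ k, i ≠ k ∧ a ≠ k ∧ b ≠ k) :
    obj t a ⟶ obj t b :=
  nerve.homEquiv ((edge a b hab h).map t)

lemma map_comp (a b c : Fin (n + 3)) (hab : a ≤ b) (hbc : b ≤ c)
    (h : ∃ k, i ≠ k ∧ a ≠ k ∧ b ≠ k ∧ c ≠ k) :
    map t a b hab (h.imp (by tauto)) ≫ map t b c hbc (h.imp (by tauto)) =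
      map t a c (hab.trans hbc) (h.imp (by tauto)) :=
  nerve.homEquiv_comp ((compStruct a b c hab hbc h).map t)

/-- In dimension at least two there is a third vertex `k`, so the edge joining `i` and `j` lies in
the face opposite `k`, which belongs to the horn. The repeated condition matches the shape required
by `map`. -/
lemma exists_ne_ne (i j : Fin (n + 3)) : ∃ k, i ≠ k ∧ i ≠ k ∧ j ≠ k := by
  obtain ⟨k, -, hk⟩ := Finset.exists_mem_notMem_of_card_lt_card
    (s := {i, j}) (t := (Finset.univ : Finset (Fin (n + 3))))
    (lt_of_le_of_lt Finset.card_le_two (by simp))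
  simp only [Finset.mem_insert, Finset.mem_singleton, not_or] at hk
  exact ⟨k, Ne.symm hk.1, Ne.symm hk.1, Ne.symm hk.2⟩

variable [IsGroupoid G]

open Classical in
/-- The morphisms from the image of the distinguished vertex of the horn. -/
noncomputable def star (a : Fin (n + 3)) : obj t i ⟶ obj t a :=
  if h : i ≤ a then map t i a h (exists_ne_ne i a)
  else inv (map t a i (le_of_not_ge h) ((exists_ne_ne i a).imp (by tauto)))

/-- The triangle on `i`, `a`, `b` misses `k`, so it lies in the horn. The cases are the three
possible positions of `i` relative to `a ≤ b`. -/
lemma star_comp_map (a b : Fin (n + 3)) (hab : a ≤ b) (h : ∃ k, i ≠ k ∧ a ≠ k ∧ b ≠ k) :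
    star t a ≫ map t a b hab h = star t b := by
  by_cases ha : i ≤ a
  · rw [star, star, dif_pos ha, dif_pos (ha.trans hab)]
    exact map_comp t i a b ha hab (h.imp (by tauto))
  · by_cases hb : i ≤ b
    · rw [star, star, dif_neg ha, dif_pos hb, IsIso.inv_comp_eq]
      exact (map_comp t a i b _ hb (h.imp (by tauto))).symm
    · rw [star, star, dif_neg ha, dif_neg hb, IsIso.inv_comp_eq, IsIso.eq_comp_inv]
      exact map_comp t a b i hab _ (h.imp (by tauto))

/-- The extension of a map from a horn to the nerve of a groupoid, as a simplex. -/
noncomputable def simplex : ComposableArrows G (n + 2) where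
  obj := obj t
  map {a b} _ := inv (star t a) ≫ star t b

/-- Comparison on edges suffices. An edge of the horn misses some vertex `k ≠ i`, so `star_comp_map`
identifies it with the edge of the filler, which runs through vertex `i`. -/
lemma fac : (horn (n + 2) i).ι ≫ (SSet.yonedaEquiv (X := nerve G) (n := ⦋n + 2⦌)).symm (simplex t) = t := by
  apply hom_ext_of_edges
  intro e
  obtain ⟨k, hki, hk⟩ := (mem_horn_iff_notMem_range _ _).1 e.2
  have h : ∃ k, i ≠ k ∧ e.1 0 ≠ k ∧ e.1 1 ≠ k :=
    ⟨k, hki.symm, fun h => hk ⟨0, h⟩, fun h => hk ⟨1, h⟩⟩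
  have hle : e.1 0 ≤ e.1 1 := stdSimplex.monotone_apply e.1 (Fin.zero_le 1)
  have he : e = (edge _ _ hle h).edge :=
    Subtype.ext (SSet.stdSimplex.ext _ _ fun x => by fin_cases x <;> rfl)
  rw [he]
  have h₁ : t.app _ (edge _ _ hle h).edge = ComposableArrows.mk₁ (map t _ _ hle h) :=
    ((nerve.mk₁_homEquiv_apply ((edge _ _ hle h).map t)).trans
      (ComposableArrows.mk₁_hom _)).symm
  refine Eq.trans ?_ h₁.symm
  have h₂ : inv (star t (e.1 0)) ≫ star t (e.1 1) = map t _ _ hle h := by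
    rw [IsIso.inv_comp_eq]
    exact (star_comp_map t _ _ hle h).symm
  exact ComposableArrows.ext₁ rfl rfl
    (h₂.trans ((Category.id_comp _).trans (Category.comp_id _)).symm)

end hornStar

open HomotopicalAlgebra modelCategoryQuillen in
/-- The nerve of a groupoid is a Kan complex. -/
lemma kanComplex_nerve (G : Type) [SmallCategory G] [IsGroupoid G] : KanComplex (nerve G) := by
  refine (isFibrant_iff _).2 ⟨?_⟩
  rw [fibrations_eq]
  intro _ _ _ hf
  simp only [J, MorphismProperty.iSup_iff] at hf
  obtain ⟨n, ⟨i⟩⟩ := hf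
  suffices ∀ t : (Λ[n + 1, i] : SSet.{0}) ⟶ nerve G, ∃ l : Δ[n + 1] ⟶ nerve G,
      (horn (n + 1) i).ι ≫ l = t by
    refine ⟨fun {t _} _ => ?_⟩
    obtain ⟨l, hl⟩ := this t
    exact ⟨⟨{ l := l, fac_left := hl, fac_right := by subsingleton }⟩⟩
  intro t
  obtain _ | n := n
  -- A one-dimensional horn is a single point, and a degenerate edge fills it.
  · obtain ⟨j, hj⟩ : ∃ j : Fin 2, j ≠ i := exists_ne i
    refine ⟨stdSimplex.σ 0 ≫ horn.ι i j hj ≫ t, horn.hom_ext' fun k hk => ?_⟩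
    obtain rfl : k = j := by
      fin_cases i <;> fin_cases j <;> fin_cases k <;> simp_all
    rw [horn.ι_ι_assoc]
    fin_cases k
    · exact CosimplicialObject.δ_comp_σ_self_assoc (i := (0 : Fin 1)) _ _
    · exact CosimplicialObject.δ_comp_σ_succ_assoc (i := (0 : Fin 1)) _ _
  · exact ⟨_, hornStar.fac t⟩

end Kan

section

variable {C D : Type} [SmallCategory C] [SmallCategory D] [IsGroupoid C] [IsGroupoid D]

/-- A functor between groupoids whose nerve is a weak equivalence is an equivalence. -/
lemma isEquivalence_of_weakEq (F : C ⥤ D) (h : weakEq (nerveMap F)) : F.IsEquivalence := by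
  rw [weakEq_iff] at h
  -- As the nerve of `C` is Kan, its identity extends along the nerve of `F` up to homotopy; this
  -- produces the candidate inverse.
  obtain ⟨g, hg⟩ := (h _ (kanComplex_nerve C)).2 (𝟙 _)
  obtain ⟨G, rfl⟩ := nerveMap_surjective g
  obtain ⟨e⟩ := iso_of_hoEq (F := F ⋙ G) (G := 𝟭 C) hg
  -- `G ⋙ F` and the identity agree up to homotopy after precomposition with `F`, and this
  -- precomposition is injective on homotopy classes.
  obtain ⟨e'⟩ := iso_of_hoEq (F := G ⋙ F) (G := 𝟭 D) ((h _ (kanComplex_nerve D)).1 _ _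
    (hoEq_nerveMap (F := F ⋙ G ⋙ F) (G := F ⋙ 𝟭 D) (Functor.isoWhiskerRight e F)))
  exact (CategoryTheory.Equivalence.mk F G e.symm e').isEquivalence_functor

end

open SSet Opposite

/-! ### Edges and triangles in strictly Segal simplicial sets -/

section Simplex

variable {X : SSet.{0}} {n : ℕ}

/-- The edge between two vertices of a simplex. -/
def edgeOf (s : X _⦋n⦌) (a b : Fin (n + 1)) (h : a ≤ b) :
    X.Edge (X.map (SimplexCategory.const ⦋0⦌ ⦋n⦌ a).op s)
      (X.map (SimplexCategory.const ⦋0⦌ ⦋n⦌ b).op s) :=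
  .mk (X.map (SimplexCategory.mkOfLe a b h).op s)
    (by
      rw [SimplicialObject.δ_def, ← Functor.map_comp_apply, ← op_comp]
      refine congrArg (fun q : ⦋0⦌ ⟶ ⦋n⦌ => X.map q.op s) ?_
      ext i; fin_cases i; rfl)
    (by
      rw [SimplicialObject.δ_def, ← Functor.map_comp_apply, ← op_comp]
      refine congrArg (fun q : ⦋0⦌ ⟶ ⦋n⦌ => X.map q.op s) ?_
      ext i; fin_cases i; rfl)

/-- The triangle between three vertices of a simplex. -/
def compStructOf (s : X _⦋n⦌) (a b c : Fin (n + 1)) (hab : a ≤ b) (hbc : b ≤ c) :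
    Edge.CompStruct (edgeOf s a b hab) (edgeOf s b c hbc) (edgeOf s a c (hab.trans hbc)) :=
  .mk (X.map (SimplexCategory.mkOfLeComp a b c hab hbc).op s)
    (by
      rw [SimplicialObject.δ_def, ← Functor.map_comp_apply, ← op_comp]
      refine congrArg (fun q : ⦋1⦌ ⟶ ⦋n⦌ => X.map q.op s) ?_
      ext i; fin_cases i <;> rfl)
    (by
      rw [SimplicialObject.δ_def, ← Functor.map_comp_apply, ← op_comp]
      refine congrArg (fun q : ⦋1⦌ ⟶ ⦋n⦌ => X.map q.op s) ?_
      ext i; fin_cases i <;> rfl)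
    (by
      rw [SimplicialObject.δ_def, ← Functor.map_comp_apply, ← op_comp]
      refine congrArg (fun q : ⦋1⦌ ⟶ ⦋n⦌ => X.map q.op s) ?_
      ext i; fin_cases i <;> rfl)

lemma edgeOf_self (s : X _⦋n⦌) (a : Fin (n + 1)) : edgeOf s a a le_rfl = Edge.id _ := by
  ext
  refine Eq.trans ?_ (Functor.map_comp_apply X _ _ s)
  refine congrArg (fun q : ⦋1⦌ ⟶ ⦋n⦌ => X.map q.op s) (?_ : SimplexCategory.mkOfLe a a le_rfl =
    SimplexCategory.σ 0 ≫ SimplexCategory.const ⦋0⦌ ⦋n⦌ a)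
  ext i; fin_cases i <;> rfl

variable [X.IsStrictSegal]

/-- A triangle is determined by its two short edges, hence so is its long edge: composition of edges
is single-valued. -/
lemma edge_unique {x y z : X _⦋0⦌} {e : X.Edge x y} {f : X.Edge y z} {g g' : X.Edge x z}
    (h : Edge.CompStruct e f g) (h' : Edge.CompStruct e f g') : g = g' := by
  have : h.simplex = h'.simplex := by
    apply (IsStrictSegal.segal (X := X) 2).injective
    apply Path.ext'
    intro i
    fin_cases i
    · refine Eq.trans ?_ ((h.d₂.trans h'.d₂.symm).trans ?_)
      · exact congrArg (fun q : ⦋1⦌ ⟶ ⦋2⦌ => X.map q.op h.simplex)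
          SimplexCategory.mkOfSucc_zero_eq_δ
      · exact congrArg (fun q : ⦋1⦌ ⟶ ⦋2⦌ => X.map q.op h'.simplex)
          SimplexCategory.mkOfSucc_zero_eq_δ.symm
    · refine Eq.trans ?_ ((h.d₀.trans h'.d₀.symm).trans ?_)
      · exact congrArg (fun q : ⦋1⦌ ⟶ ⦋2⦌ => X.map q.op h.simplex)
          SimplexCategory.mkOfSucc_one_eq_δ
      · exact congrArg (fun q : ⦋1⦌ ⟶ ⦋2⦌ => X.map q.op h'.simplex)
          SimplexCategory.mkOfSucc_one_eq_δ.symm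
  ext
  rw [← h.d₁, ← h'.d₁, this]

lemma exists_compStruct {x y z : X _⦋0⦌} (e : X.Edge x y) (f : X.Edge y z) :
    ∃ g : X.Edge x z, Nonempty (Edge.CompStruct e f g) := by
  obtain ⟨s, hs⟩ := (IsStrictSegal.segal (X := X) 2).surjective
    { vertex := ![x, y, z]
      arrow := ![e.edge, f.edge]
      arrow_src := fun i => by
        fin_cases i
        · exact e.src_eq
        · exact f.src_eq
      arrow_tgt := fun i => by
        fin_cases i
        · exact e.tgt_eq
        · exact f.tgt_eq }
  have h₂ : X.δ 2 s = e.edge :=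
    (congrArg (fun q : ⦋1⦌ ⟶ ⦋2⦌ => X.map q.op s) SimplexCategory.mkOfSucc_zero_eq_δ.symm).trans
      (Path.congr_arrow hs 0)
  have h₀ : X.δ 0 s = f.edge :=
    (congrArg (fun q : ⦋1⦌ ⟶ ⦋2⦌ => X.map q.op s) SimplexCategory.mkOfSucc_one_eq_δ.symm).trans
      (Path.congr_arrow hs 1)
  refine ⟨.mk (X.δ 1 s) ?_ ?_, ⟨.mk s h₂ h₀ rfl⟩⟩
  · rw [← e.src_eq, ← h₂]
    exact congrArg (fun q => q s) (X.δ_comp_δ (i := (1 : Fin 2)) (j := 1) le_rfl).symm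
  · rw [← f.tgt_eq, ← h₀]
    exact congrArg (fun q => q s) (X.δ_comp_δ (i := (0 : Fin 2)) (j := 0) le_rfl)

/-- A path of three edges is the spine of a 3-simplex. Vertices and edges are compared by separate
equations because the endpoints agree only propositionally; associativity substitutes them in turn.
-/
lemma exists_simplex_three {x y z w : X _⦋0⦌} (e : X.Edge x y) (f : X.Edge y z) (g : X.Edge z w) :
    ∃ s : X _⦋3⦌, X.map (SimplexCategory.const ⦋0⦌ ⦋3⦌ 0).op s = x ∧
      X.map (SimplexCategory.const ⦋0⦌ ⦋3⦌ 1).op s = y ∧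
      X.map (SimplexCategory.const ⦋0⦌ ⦋3⦌ 2).op s = z ∧
      X.map (SimplexCategory.const ⦋0⦌ ⦋3⦌ 3).op s = w ∧
      (edgeOf s 0 1 (by decide)).edge = e.edge ∧ (edgeOf s 1 2 (by decide)).edge = f.edge ∧
      (edgeOf s 2 3 (by decide)).edge = g.edge := by
  obtain ⟨s, hs⟩ := (IsStrictSegal.segal (X := X) 3).surjective
    { vertex := ![x, y, z, w]
      arrow := ![e.edge, f.edge, g.edge]
      arrow_src := fun i => by
        fin_cases i
        · exact e.src_eq
        · exact f.src_eq
        · exact g.src_eq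
      arrow_tgt := fun i => by
        fin_cases i
        · exact e.tgt_eq
        · exact f.tgt_eq
        · exact g.tgt_eq }
  exact ⟨s, Path.congr_vertex hs 0, Path.congr_vertex hs 1, Path.congr_vertex hs 2,
    Path.congr_vertex hs 3, Path.congr_arrow hs 0, Path.congr_arrow hs 1, Path.congr_arrow hs 2⟩

end Simplex

/-! ### The category of edges and its nerve -/

/-- The category of edges of a simplicial set that satisfies the strict Segal condition. -/
structure EdgeCat (X : SSet.{0}) where
  pt : X _⦋0⦌

namespace EdgeCat

variable {X : SSet.{0}} [X.IsStrictSegal]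

noncomputable instance : CategoryStruct (EdgeCat X) where
  Hom x y := X.Edge x.pt y.pt
  id x := Edge.id x.pt
  comp e f := (exists_compStruct e f).choose

lemma comp_eq {x y z : EdgeCat X} {e : x ⟶ y} {f : y ⟶ z} {g : x ⟶ z}
    (h : Edge.CompStruct (X := X) e f g) : e ≫ f = g :=
  edge_unique (exists_compStruct (X := X) e f).choose_spec.some h

noncomputable instance : SmallCategory (EdgeCat X) where
  id_comp e := comp_eq (Edge.CompStruct.idComp (X := X) e)
  comp_id e := comp_eq (Edge.CompStruct.compId (X := X) e)
  assoc {x y z w} e f g := by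
    obtain ⟨x⟩ := x
    obtain ⟨y⟩ := y
    obtain ⟨z⟩ := z
    obtain ⟨w⟩ := w
    obtain ⟨s, rfl, rfl, rfl, rfl, he, hf, hg⟩ := exists_simplex_three (X := X) e f g
    obtain rfl := Edge.ext he
    obtain rfl := Edge.ext hf
    obtain rfl := Edge.ext hg
    let v (i : Fin 4) : EdgeCat X := ⟨X.map (SimplexCategory.const ⦋0⦌ ⦋3⦌ i).op s⟩
    -- Each face of the 3-simplex is one composition law; the four faces together give
    -- associativity.
    have key (a b c : Fin 4) (hab : a ≤ b) (hbc : b ≤ c) :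
        CategoryStruct.comp (X := v a) (Y := v b) (Z := v c) (edgeOf s a b hab) (edgeOf s b c hbc)
          = edgeOf s a c (hab.trans hbc) := comp_eq (compStructOf s a b c hab hbc)
    have h1 := key 0 1 2 (by decide) (by decide)
    have h2 := key 1 2 3 (by decide) (by decide)
    refine (congrArg (fun q : v 0 ⟶ v 2 => q ≫ (edgeOf s 2 3 (by decide) : v 2 ⟶ v 3)) h1).trans
      (Eq.trans ?_ (congrArg (fun q : v 1 ⟶ v 3 =>
        (edgeOf s 0 1 (by decide) : v 0 ⟶ v 1) ≫ q) h2).symm)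
    exact (key 0 2 3 (by decide) (by decide)).trans (key 0 1 3 (by decide) (by decide)).symm

lemma hom_heq {x x' y y' : EdgeCat X} (hx : x = x') (hy : y = y') (e : x ⟶ y) (e' : x' ⟶ y')
    (h : Edge.edge (X := X) e = Edge.edge (X := X) e') : HEq e e' := by
  subst hx hy
  exact heq_of_eq (Edge.ext h)

/-- Objects need no separate hypothesis: they are the endpoints of the edges underlying identities.
-/
lemma functor_ext {J : Type} [SmallCategory J] {F G : J ⥤ EdgeCat X}
    (h : ∀ {a b : J} (f : a ⟶ b),
      Edge.edge (X := X) (F.map f) = Edge.edge (X := X) (G.map f)) : F = G := by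
  have hobj (a : J) : F.obj a = G.obj a := by
    have := congrArg (X.δ 0) (h (𝟙 a))
    rw [Edge.tgt_eq, Edge.tgt_eq] at this
    exact congrArg EdgeCat.mk this
  exact CategoryTheory.Functor.hext hobj fun a b f => hom_heq (hobj a) (hobj b) _ _ (h f)

variable (X) in
/-- The comparison of a simplicial set with the nerve of its category of edges. -/
noncomputable def toNerve : X ⟶ nerve (EdgeCat X) where
  app n := ↾fun s =>
    { obj := fun i => ⟨X.map (SimplexCategory.const ⦋0⦌ n.unop i).op s⟩
      map := fun {a b} h => edgeOf (n := n.unop.len) s a b (leOfHom h)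
      map_id := fun a => edgeOf_self (n := n.unop.len) s a
      map_comp := fun {a b c} h h' =>
        (comp_eq (compStructOf (n := n.unop.len) s a b c (leOfHom h) (leOfHom h'))).symm }
  naturality m n θ := by
    ext s
    refine functor_ext fun {a b} h => ?_
    refine (Functor.map_comp_apply X _ _ s).symm.trans ?_
    refine congrArg (fun q : ⦋1⦌ ⟶ m.unop => X.map q.op s) ?_
    change SimplexCategory.mkOfLe a b (leOfHom h) ≫ θ.unop = _
    ext i; fin_cases i <;> rfl

lemma edge_congr {J : Type} [SmallCategory J] {F G : J ⥤ EdgeCat X} (h : F = G) {a b : J}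
    (f : a ⟶ b) : Edge.edge (X := X) (F.map f) = Edge.edge (X := X) (G.map f) := by
  rw [h]

/-- On both sides an `n`-simplex amounts to its spine, and the two notions of spine coincide. -/
lemma toNerve_bijective (n : ℕ) : Function.Bijective ((toNerve X).app (op ⦋n⦌)) := by
  refine ⟨fun s s' h => ?_, fun F => ?_⟩
  · apply (IsStrictSegal.segal (X := X) n).injective
    refine SSet.Path.ext (funext fun i => ?_) (funext fun i => ?_)
    · exact congrArg EdgeCat.pt (Functor.congr_obj h i)
    · exact edge_congr h (homOfLE i.castSucc_le_succ)
  · change ComposableArrows (EdgeCat X) n at F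
    obtain ⟨s, hs⟩ := (IsStrictSegal.segal (X := X) n).surjective
      { vertex := fun i => (F.obj i).pt
        arrow := fun i => Edge.edge (X := X) (F.map (homOfLE i.castSucc_le_succ))
        arrow_src := fun i => Edge.src_eq _
        arrow_tgt := fun i => Edge.tgt_eq _ }
    refine ⟨s, ?_⟩
    have hobj (i : Fin (n + 1)) : ((toNerve X).app (op ⦋n⦌) s).obj i = F.obj i :=
      congrArg EdgeCat.mk (Path.congr_vertex hs i)
    refine ComposableArrows.ext hobj fun i hi => ?_
    rw [← heq_eq_eq]
    refine HEq.trans ?_ (HEq.symm (by simp : HEq (eqToHom (hobj _) ≫ F.map' i (i + 1) ≫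
      eqToHom (hobj _).symm) (F.map' i (i + 1))))
    exact hom_heq (hobj _) (hobj _) _ _ (Path.congr_arrow hs ⟨i, hi⟩)

instance : IsIso (toNerve X) := by
  have (n : SimplexCategoryᵒᵖ) : IsIso ((toNerve X).app n) := by
    rw [isIso_iff_bijective]
    exact toNerve_bijective n.unop.len
  exact NatIso.isIso_of_isIso_app _

/-- The triangles give each morphism a right inverse. A right inverse has a right inverse in turn,
which must be the original morphism, so the inverses are two-sided. -/
lemma isGroupoid (h : ∀ e : X _⦋1⦌, ∃ s : X _⦋2⦌, X.δ 2 s = e ∧ X.δ 1 s = X.σ 0 (X.δ 1 e)) :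
    IsGroupoid (EdgeCat X) := by
  have key {x y : EdgeCat X} (e : x ⟶ y) : ∃ f : y ⟶ x, e ≫ f = 𝟙 x := by
    obtain ⟨s, h₂, h₁⟩ := h (Edge.edge (X := X) e)
    have hsrc := Edge.src_eq (X := X) e
    have htgt := Edge.tgt_eq (X := X) e
    rw [hsrc] at h₁
    let f : X.Edge y.pt x.pt := .mk (X.δ 0 s)
      (by
        rw [← htgt, ← h₂]
        exact congrArg (fun q => q s) (X.δ_comp_δ (i := (0 : Fin 2)) (j := 1) (by decide)).symm)
      (by
        have := congrArg (X.δ 0) h₁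
        rw [δ_σ_zero] at this
        rw [← this]
        exact congrArg (fun q => q s) (X.δ_comp_δ (i := (0 : Fin 2)) (j := 0) le_rfl).symm)
    exact ⟨f, comp_eq (Edge.CompStruct.mk s h₂ rfl h₁)⟩
  refine ⟨fun {x y} e => ?_⟩
  obtain ⟨f, hf⟩ := key e
  obtain ⟨g, hg⟩ := key f
  refine ⟨f, hf, ?_⟩
  have : e = g := by
    rw [← Category.comp_id e, ← hg, ← Category.assoc, hf, Category.id_comp]
  rwa [← this] at hg

end EdgeCat

/-- Every edge of `X` is the first edge of a triangle whose long edge is degenerate. -/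
class HasInverses (X : SSet.{0}) : Prop where
  exists_triangle (X) (e : X _⦋1⦌) : ∃ s : X _⦋2⦌, X.δ 2 s = e ∧ X.δ 1 s = X.σ 0 (X.δ 1 e)

instance (X : SSet.{0}) [X.IsStrictSegal] [HasInverses X] : IsGroupoid (EdgeCat X) :=
  EdgeCat.isGroupoid (HasInverses.exists_triangle X)

instance (C : Type) [SmallCategory C] [IsGroupoid C] : HasInverses (nerve C) where
  exists_triangle e := by
    obtain ⟨x, y, f, rfl⟩ := ComposableArrows.mk₁_surjective e
    obtain ⟨h⟩ := (nerve.nonempty_compStruct_iff f (inv f) (𝟙 x)).2 (IsIso.hom_inv_id f)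
    refine ⟨h.simplex, h.d₂, h.d₁.trans ?_⟩
    rw [nerve.edgeMk_id]
    exact congrArg ((nerve C).σ 0) (nerve.edgeMk f).src_eq.symm

namespace EdgeCat

variable {X Y Z : SSet.{0}} [X.IsStrictSegal] [Y.IsStrictSegal] [Z.IsStrictSegal]

/-- A map of simplicial sets induces a functor between the categories of edges. -/
noncomputable def map (f : X ⟶ Y) : EdgeCat X ⥤ EdgeCat Y where
  obj x := ⟨f.app _ x.pt⟩
  map e := Edge.map e f
  map_id _ := Edge.map_id (X := X) _ f
  map_comp e e' :=
    (comp_eq ((exists_compStruct (X := X) e e').choose_spec.some.map f)).symm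

lemma toNerve_naturality (f : X ⟶ Y) : f ≫ toNerve Y = toNerve X ≫ nerveMap (map f) := by
  apply NatTrans.ext
  funext n
  ext s
  refine functor_ext fun {a b} h => ?_
  exact (app_map f _ s).symm

variable {C D : Type} [SmallCategory C] [SmallCategory D]

/-- A map out of a nerve induces a functor to the category of edges. -/
noncomputable def ofNerve (j : nerve C ⟶ X) : C ⥤ EdgeCat X where
  obj c := ⟨j.app _ (nerveEquiv.symm c)⟩
  map u := (nerve.edgeMk u).map j
  map_id c := by
    rw [nerve.edgeMk_id]
    exact Edge.map_id (X := nerve C) _ j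
  map_comp u v :=
    (comp_eq (((nerve.nonempty_compStruct_iff u v (u ≫ v)).2 rfl).some.map j)).symm

lemma ofNerve_nerveMap (F : C ⥤ D) (j : nerve D ⟶ X) :
    ofNerve (nerveMap F ≫ j) = F ⋙ ofNerve j := by
  refine functor_ext fun {a b} f => ?_
  refine congrArg (j.app (op ⦋1⦌)) ?_
  exact ComposableArrows.ext₁ rfl rfl ((Category.id_comp _).trans (Category.comp_id _)).symm

end EdgeCat

/-! ### Sequential colimits along an endomorphism -/

/-- The iterates of an endomorphism. -/
def iter {Y : SSet.{0}} (φ : Y ⟶ Y) (m : ℕ) : Y ⟶ Y :=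
  m.rec (𝟙 Y) fun _ f => f ≫ φ

lemma iter_add {Y : SSet.{0}} (φ : Y ⟶ Y) (m m' : ℕ) : iter φ (m + m') = iter φ m ≫ iter φ m' := by
  induction m' with
  | zero => rfl
  | succ m' ih => 
    change iter φ (m + m') ≫ φ = _
    rw [ih]
    rfl

lemma iter_comm {Y Y' : SSet.{0}} {φ : Y ⟶ Y} {ψ : Y' ⟶ Y'} {f : Y ⟶ Y'} (h : φ ≫ f = f ≫ ψ)
    (m : ℕ) : iter φ m ≫ f = f ≫ iter ψ m := by
  induction m with
  | zero => rfl
  | succ m ih =>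
    change (iter φ m ≫ φ) ≫ f = f ≫ iter ψ m ≫ ψ
    rw [Category.assoc, h, ← Category.assoc, ih, Category.assoc]

/-- The maps `j k : Y ⟶ X` exhibit `X` as the colimit of `Y ⟶ Y ⟶ Y ⟶ ⋯`. -/
structure IsTel {Y X : SSet.{0}} (φ : Y ⟶ Y) (j : ℕ → (Y ⟶ X)) : Prop where
  comp (k : ℕ) : φ ≫ j (k + 1) = j k
  surj {n : SimplexCategoryᵒᵖ} (x : X.obj n) : ∃ k y, (j k).app n y = x
  eq {n : SimplexCategoryᵒᵖ} {k : ℕ} {y y' : Y.obj n} (h : (j k).app n y = (j k).app n y') :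
    ∃ m, (iter φ m).app n y = (iter φ m).app n y'

namespace IsTel

variable {Y X : SSet.{0}} {φ : Y ⟶ Y} {j : ℕ → (Y ⟶ X)} (T : IsTel φ j)

include T

lemma iter_comp (k m : ℕ) : iter φ m ≫ j (k + m) = j k := by
  induction m with
  | zero => rfl
  | succ m ih =>
    change (iter φ m ≫ φ) ≫ j (k + m + 1) = _
    rw [Category.assoc, T.comp, ih]

lemma app_iter {n : SimplexCategoryᵒᵖ} (k m : ℕ) (y : Y.obj n) :
    (j (k + m)).app n ((iter φ m).app n y) = (j k).app n y :=
  congrArg (fun f : Y ⟶ X => f.app n y) (T.iter_comp k m)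

/-- Finitely many simplices lift to a common stage. The dimension may vary with the index, so that
the vertices and edges of a path can be lifted together. -/
lemma surj_family {ι : Type} [Finite ι] {n : ι → SimplexCategoryᵒᵖ} (x : ∀ i, X.obj (n i)) :
    ∃ k, ∃ y : ∀ i, Y.obj (n i), ∀ i, (j k).app (n i) (y i) = x i := by
  choose k y h using fun i => T.surj (x i)
  obtain ⟨K, hK⟩ := Finite.exists_le k
  refine ⟨K, fun i => (iter φ (K - k i)).app _ (y i), fun i => ?_⟩
  rw [← h i, ← T.app_iter (k i) (K - k i), Nat.add_sub_cancel' (hK i)]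

lemma eq_family {ι : Type} [Finite ι] {n : ι → SimplexCategoryᵒᵖ} {k : ℕ}
    {y y' : ∀ i, Y.obj (n i)} (h : ∀ i, (j k).app (n i) (y i) = (j k).app (n i) (y' i)) :
    ∃ m, ∀ i, (iter φ m).app (n i) (y i) = (iter φ m).app (n i) (y' i) := by
  choose m hm using fun i => T.eq (h i)
  obtain ⟨K, hK⟩ := Finite.exists_le m
  refine ⟨K, fun i => ?_⟩
  have := congrArg ((iter φ (K - m i)).app (n i)) (hm i)
  rw [← Nat.add_sub_cancel' (hK i), iter_add]
  exact this

/-- Finite powers commute with sequential colimits, since finitely many coordinates lift to, and are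
identified at, a common stage. -/
lemma pow (ι : Type) [Finite ι] :
    IsTel ((powFunctor ι).map φ) fun k => (powFunctor ι).map (j k) where
  comp k := congrArg (powFunctor ι).map (T.comp k)
  surj {n} x := by
    obtain ⟨k, y, h⟩ := T.surj_family (n := fun _ => n) x
    exact ⟨k, y, funext h⟩
  eq {n k y y'} h := by
    obtain ⟨m, hm⟩ := T.eq_family (n := fun _ => n) (k := k) (y := y) (y' := y')
      fun i => congrFun h i
    have (m : ℕ) : iter ((powFunctor ι).map φ) m = (powFunctor ι).map (iter φ m) := by
      induction m with
      | zero => rfl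
      | succ m ih => exact congrArg (fun q => q ≫ (powFunctor ι).map φ) ih
    refine ⟨m, ?_⟩
    rw [this]
    exact funext hm

/-- A spine consists of finitely many simplices subject to finitely many equations, so existence and
uniqueness of fillers can be checked at a late enough stage. -/
lemma isStrictSegal [Y.IsStrictSegal] : X.IsStrictSegal where
  segal n := by
    refine ⟨fun s s' h => ?_, fun P => ?_⟩
    · obtain ⟨k, t, ht⟩ := T.surj_family (n := fun _ => op ⦋n⦌) ![s, s']
      obtain rfl : _ = s := ht 0
      obtain rfl : _ = s' := ht 1
      obtain ⟨m, hm⟩ := T.eq_family (k := k)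
        (n := Sum.elim (fun _ : Fin (n + 1) => op ⦋0⦌) (fun _ : Fin n => op ⦋1⦌))
        (y := Sum.rec (Y.spine n (t 0)).vertex (Y.spine n (t 0)).arrow)
        (y' := Sum.rec (Y.spine n (t 1)).vertex (Y.spine n (t 1)).arrow)
        (by
          rintro (i | i)
          · exact (app_map (j k) _ (t 0)).trans
              ((Path.congr_vertex h i).trans (app_map (j k) _ (t 1)).symm)
          · exact (app_map (j k) _ (t 0)).trans
              ((Path.congr_arrow h i).trans (app_map (j k) _ (t 1)).symm))
      have : (iter φ m).app _ (t 0) = (iter φ m).app _ (t 1) := by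
        apply (IsStrictSegal.segal (X := Y) n).injective
        refine SSet.Path.ext (funext fun i => ?_) (funext fun i => ?_)
        · exact (app_map _ _ _).symm.trans ((hm (.inl i)).trans (app_map _ _ _))
        · exact (app_map _ _ _).symm.trans ((hm (.inr i)).trans (app_map _ _ _))
      have := congrArg ((j (k + m)).app _) this
      rwa [T.app_iter, T.app_iter] at this
    · obtain ⟨k, y, hy⟩ := T.surj_family
        (n := Sum.elim (fun _ : Fin (n + 1) => op ⦋0⦌) (fun _ : Fin n => op ⦋1⦌))
        (Sum.rec P.vertex P.arrow)
      let v (i : Fin (n + 1)) : Y _⦋0⦌ := y (.inl i)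
      let a (i : Fin n) : Y _⦋1⦌ := y (.inr i)
      have hv (i : Fin (n + 1)) : (j k).app _ (v i) = P.vertex i := hy (.inl i)
      have ha (i : Fin n) : (j k).app _ (a i) = P.arrow i := hy (.inr i)
      -- The lifted vertices and edges need not form a path yet. The source and target equations
      -- hold in the colimit, hence after `m` further steps.
      obtain ⟨m, hm⟩ := T.eq_family (k := k) (ι := Fin n ⊕ Fin n) (n := fun _ => op ⦋0⦌)
        (y := Sum.elim (fun i => Y.δ 1 (a i)) (fun i => Y.δ 0 (a i)))
        (y' := Sum.elim (fun i => v i.castSucc) (fun i => v i.succ))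
        (by
          rintro (i | i)
          · refine (app_δ _ _ _).trans (Eq.trans ?_ (hv _).symm)
            rw [ha]
            exact P.arrow_src i
          · refine (app_δ _ _ _).trans (Eq.trans ?_ (hv _).symm)
            rw [ha]
            exact P.arrow_tgt i)
      obtain ⟨s, hs⟩ := (IsStrictSegal.segal (X := Y) n).surjective
        { vertex := fun i => (iter φ m).app _ (v i)
          arrow := fun i => (iter φ m).app _ (a i)
          arrow_src := fun i => (app_δ _ 1 _).symm.trans (hm (.inl i))
          arrow_tgt := fun i => (app_δ _ 0 _).symm.trans (hm (.inr i)) }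
      refine ⟨(j (k + m)).app _ s, ?_⟩
      refine SSet.Path.ext (funext fun i => ?_) (funext fun i => ?_)
      · refine (app_map _ _ _).symm.trans ?_
        refine (congrArg ((j (k + m)).app _) (Path.congr_vertex hs i)).trans ?_
        exact (T.app_iter _ _ _).trans (hv i)
      · refine (app_map _ _ _).symm.trans ?_
        refine (congrArg ((j (k + m)).app _) (Path.congr_arrow hs i)).trans ?_
        exact (T.app_iter _ _ _).trans (ha i)

lemma hasInverses [HasInverses Y] : HasInverses X where
  exists_triangle e := by
    obtain ⟨k, e, rfl⟩ := T.surj e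
    obtain ⟨s, h₂, h₁⟩ := HasInverses.exists_triangle Y e
    refine ⟨(j k).app _ s, ?_, ?_⟩
    · rw [← app_δ, h₂]
    · rw [← app_δ, ← app_δ, ← app_σ, h₁]

end IsTel

/-- Full faithfulness and essential surjectivity, in terms of edges. -/
structure IsEdgeEquiv {X Y : SSet.{0}} (f : X ⟶ Y) : Prop where
  faithful {e e' : X _⦋1⦌} (h₁ : X.δ 1 e = X.δ 1 e') (h₀ : X.δ 0 e = X.δ 0 e')
    (h : f.app _ e = f.app _ e') : e = e'
  full {x y : X _⦋0⦌} {u : Y _⦋1⦌} (h₁ : Y.δ 1 u = f.app _ x) (h₀ : Y.δ 0 u = f.app _ y) :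
    ∃ e : X _⦋1⦌, X.δ 1 e = x ∧ X.δ 0 e = y ∧ f.app _ e = u
  essSurj (y : Y _⦋0⦌) : ∃ (x : X _⦋0⦌) (u : Y _⦋1⦌), Y.δ 1 u = f.app _ x ∧ Y.δ 0 u = y

lemma IsEdgeEquiv.comp_iso {X Y Z : SSet.{0}} {f : X ⟶ Y} (hf : IsEdgeEquiv f) (g : Y ≅ Z) :
    IsEdgeEquiv (f ≫ g.hom) := by
  have hg {n : ℕ} (y : Z _⦋n⦌) : g.hom.app _ (g.inv.app _ y) = y :=
    congrArg (fun q : Z ⟶ Z => q.app (op ⦋n⦌) y) g.inv_hom_id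
  have hg' {n : ℕ} (y : Y _⦋n⦌) : g.inv.app _ (g.hom.app _ y) = y :=
    congrArg (fun q : Y ⟶ Y => q.app (op ⦋n⦌) y) g.hom_inv_id
  refine ⟨fun h₁ h₀ h => hf.faithful h₁ h₀ ?_, fun {x y u} h₁ h₀ => ?_, fun y => ?_⟩
  · have := congrArg (g.inv.app _) h
    exact (hg' _).symm.trans (this.trans (hg' _))
  · obtain ⟨e, he₁, he₀, he⟩ := hf.full (u := g.inv.app _ u)
      (by rw [← app_δ, h₁]; exact hg' _) (by rw [← app_δ, h₀]; exact hg' _)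
    refine ⟨e, he₁, he₀, ?_⟩
    change g.hom.app _ (f.app _ e) = u
    rw [he, hg]
  · obtain ⟨x, u, h₁, h₀⟩ := hf.essSurj (g.inv.app _ y)
    refine ⟨x, g.hom.app _ u, ?_, ?_⟩
    · rw [← app_δ, h₁]
      rfl
    · rw [← app_δ, h₀, hg]

lemma isEdgeEquiv_nerveMap {C D : Type} [SmallCategory C] [SmallCategory D] [IsGroupoid D]
    (F : C ⥤ D) [F.IsEquivalence] : IsEdgeEquiv (nerveMap F) where
  faithful {e e'} h₁ h₀ h := by
    obtain ⟨x, y, e, rfl⟩ := ComposableArrows.mk₁_surjective e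
    obtain ⟨x', y', e', rfl⟩ := ComposableArrows.mk₁_surjective e'
    obtain rfl : x = x' := Functor.congr_obj h₁ 0
    obtain rfl : y = y' := Functor.congr_obj h₀ 0
    have key : F.map e = F.map e' :=
      (Functor.congr_hom h (homOfLE (show (0 : Fin 2) ≤ 1 by decide))).trans
        ((Category.id_comp _).trans (Category.comp_id _))
    rw [F.map_injective key]
  full {x y u} h₁ h₀ := by
    obtain ⟨a, b, u, rfl⟩ := ComposableArrows.mk₁_surjective u
    obtain ⟨x, rfl⟩ := nerveEquiv.symm.surjective x
    obtain ⟨y, rfl⟩ := nerveEquiv.symm.surjective y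
    obtain rfl : a = F.obj x := Functor.congr_obj h₁ 0
    obtain rfl : b = F.obj y := Functor.congr_obj h₀ 0
    obtain ⟨u, rfl⟩ := F.map_surjective u
    refine ⟨ComposableArrows.mk₁ u, (nerve.edgeMk u).src_eq, (nerve.edgeMk u).tgt_eq, ?_⟩
    exact ComposableArrows.ext₁ rfl rfl ((Category.id_comp _).trans (Category.comp_id _)).symm
  essSurj y := by
    obtain ⟨y, rfl⟩ := nerveEquiv.symm.surjective y
    let u := (F.objObjPreimageIso y).hom
    refine ⟨nerveEquiv.symm (F.objPreimage y), ComposableArrows.mk₁ u, ?_, ?_⟩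
    · exact (nerve.edgeMk u).src_eq.trans (ComposableArrows.ext₀ rfl)
    · exact (nerve.edgeMk u).tgt_eq

namespace IsTel

variable {Y X Y' X' : SSet.{0}} {φ : Y ⟶ Y} {j : ℕ → (Y ⟶ X)} {ψ : Y' ⟶ Y'} {j' : ℕ → (Y' ⟶ X')}

/-- Faithfulness, fullness and essential surjectivity each involve finitely many edges and vertices,
so each is inherited from a late enough stage. This carries the Segal condition to telescopes. -/
lemma isEdgeEquiv (T : IsTel φ j) (T' : IsTel ψ j') {f : Y ⟶ Y'} {f' : X ⟶ X'}
    (hφ : φ ≫ f = f ≫ ψ) (hj : ∀ k, j k ≫ f' = f ≫ j' k) (hf : IsEdgeEquiv f) :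
    IsEdgeEquiv f' := by
  have happ (k : ℕ) {n : ℕ} (y : Y _⦋n⦌) : f'.app _ ((j k).app _ y) = (j' k).app _ (f.app _ y) :=
    congrArg (fun q : Y ⟶ X' => q.app (op ⦋n⦌) y) (hj k)
  have hiter (m : ℕ) {n : ℕ} (y : Y _⦋n⦌) :
      f.app _ ((iter φ m).app _ y) = (iter ψ m).app _ (f.app _ y) :=
    congrArg (fun q : Y ⟶ Y' => q.app (op ⦋n⦌) y) (iter_comm hφ m)
  refine ⟨fun {e e'} h₁ h₀ h => ?_, fun {x y u} h₁ h₀ => ?_, fun y => ?_⟩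
  · obtain ⟨k, t, ht⟩ := T.surj_family (n := fun _ => op ⦋1⦌) ![e, e']
    obtain rfl : _ = e := ht 0
    obtain rfl : _ = e' := ht 1
    obtain ⟨m, hm⟩ := T.eq_family (k := k) (n := fun _ => op ⦋0⦌) (ι := Fin 2)
      (y := fun i => Y.δ i (t 0)) (y' := fun i => Y.δ i (t 1))
      (by
        intro i
        refine (app_δ _ _ _).trans (Eq.trans ?_ (app_δ _ _ _).symm)
        fin_cases i
        · exact h₀
        · exact h₁)
    rw [happ, happ] at h
    obtain ⟨m', hm'⟩ := T'.eq h
    have : (iter φ (m + m')).app _ (t 0) = (iter φ (m + m')).app _ (t 1) := by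
      refine hf.faithful ?_ ?_ ?_
      · rw [← app_δ, ← app_δ, iter_add]
        exact congrArg ((iter φ m').app _) (hm 1)
      · rw [← app_δ, ← app_δ, iter_add]
        exact congrArg ((iter φ m').app _) (hm 0)
      · rw [hiter, hiter, add_comm, iter_add]
        exact congrArg ((iter ψ m).app _) hm'
    rw [← T.app_iter k (m + m'), ← T.app_iter k (m + m')]
    exact congrArg ((j _).app _) this
  · obtain ⟨k, t, ht⟩ := T.surj_family (n := fun _ => op ⦋0⦌) ![x, y]
    obtain rfl : _ = x := ht 0
    obtain rfl : _ = y := ht 1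
    obtain ⟨k', u, rfl⟩ := T'.surj u
    rw [happ, ← app_δ] at h₁ h₀
    -- The endpoints live at stage `k` and the edge at stage `k'`; all of them are moved to stage `k
    -- + k'`.
    rw [← T'.app_iter k' k, ← T'.app_iter k k', add_comm k' k] at h₁ h₀
    obtain ⟨m, hm⟩ := T'.eq_family (k := k + k') (n := fun _ => op ⦋0⦌) (ι := Fin 2)
      (y := fun i => (iter ψ k).app _ (Y'.δ i u))
      (y' := fun i => (iter ψ k').app _ (f.app _ (![t 1, t 0] i)))
      (by
        intro i
        fin_cases i
        · exact h₀
        · exact h₁)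
    obtain ⟨e, he₁, he₀, he⟩ := hf.full (x := (iter φ (k' + m)).app _ (t 0))
      (y := (iter φ (k' + m)).app _ (t 1)) (u := (iter ψ (k + m)).app _ u)
      (by
        rw [hiter, ← app_δ, iter_add, iter_add]
        exact hm 1)
      (by
        rw [hiter, ← app_δ, iter_add, iter_add]
        exact hm 0)
    refine ⟨(j (k + (k' + m))).app _ e, ?_, ?_, ?_⟩
    · rw [← app_δ, he₁, T.app_iter]
    · rw [← app_δ, he₀, T.app_iter]
    · rw [happ, he, ← T'.app_iter k' (k + m), Nat.add_left_comm]
  · obtain ⟨k, y, rfl⟩ := T'.surj y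
    obtain ⟨x, u, h₁, h₀⟩ := hf.essSurj y
    refine ⟨(j k).app _ x, (j' k).app _ u, ?_, ?_⟩
    · rw [happ, ← app_δ, h₁]
    · rw [← app_δ, h₀]

end IsTel

namespace IsEdgeEquiv

variable {X Y : SSet.{0}} [X.IsStrictSegal] [Y.IsStrictSegal] [HasInverses Y] {f : X ⟶ Y}

lemma isEquivalence (hf : IsEdgeEquiv f) : (EdgeCat.map f).IsEquivalence where
  faithful := ⟨fun {x y e e'} h => by
    refine Edge.ext (hf.faithful ?_ ?_ (congrArg (Edge.edge (X := Y)) h))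
    · rw [Edge.src_eq, Edge.src_eq]
    · rw [Edge.tgt_eq, Edge.tgt_eq]⟩
  full := ⟨fun {x y} u => by
    obtain ⟨e, h₁, h₀, h⟩ := hf.full (Edge.src_eq (X := Y) u) (Edge.tgt_eq (X := Y) u)
    exact ⟨Edge.mk (X := X) e h₁ h₀, Edge.ext h⟩⟩
  essSurj := ⟨fun y => by
    obtain ⟨x, u, h₁, h₀⟩ := hf.essSurj y.pt
    let u' : (EdgeCat.map f).obj ⟨x⟩ ⟶ y := Edge.mk (X := Y) u h₁ h₀
    exact ⟨⟨x⟩, ⟨asIso u'⟩⟩⟩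

/-- Both sides are nerves of their edge categories, and under these identifications `f` is the nerve
of an equivalence. -/
lemma weakEq (hf : IsEdgeEquiv f) : weakEq f := by
  have := hf.isEquivalence
  refine weakEq_of_postcomp (weakEq_of_iso (asIso (EdgeCat.toNerve Y))) ?_
  change EInfty.weakEq (f ≫ EdgeCat.toNerve Y)
  rw [EdgeCat.toNerve_naturality]
  exact weakEq_comp (weakEq_of_iso (asIso (EdgeCat.toNerve X))) (weakEq_nerveMap _)

end IsEdgeEquiv

/-- The comparison maps to the nerves are isomorphisms, so the nerve of the functor is again a weak
equivalence. For Segal-type maps this yields an actual inverse functor on edge groupoids. -/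
lemma isEquivalence_edgeCatMap {X Y : SSet.{0}} [X.IsStrictSegal] [Y.IsStrictSegal]
    [HasInverses X] [HasInverses Y] {f : X ⟶ Y} (hf : weakEq f) :
    (EdgeCat.map f).IsEquivalence := by
  apply isEquivalence_of_weakEq
  refine fun K hK => ?_
  have h₁ := weakEq_comp hf (weakEq_of_iso (asIso (EdgeCat.toNerve Y))) K hK
  change Function.Bijective (HoClass.precomp (f ≫ EdgeCat.toNerve Y) K) at h₁
  rw [EdgeCat.toNerve_naturality, precomp_comp] at h₁
  exact (Function.Bijective.of_comp_iff' (weakEq_of_iso (asIso (EdgeCat.toNerve X)) K hK) _).1 h₁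

instance (ι : Type) (X : SSet.{0}) [X.IsStrictSegal] : ((powFunctor ι).obj X).IsStrictSegal where
  segal n := by
    refine ⟨fun s s' h => funext fun i => ?_, fun P => ?_⟩
    · apply (IsStrictSegal.segal (X := X) n).injective
      refine SSet.Path.ext (funext fun a => ?_) (funext fun a => ?_)
      · exact congrFun (Path.congr_vertex h a) i
      · exact congrFun (Path.congr_arrow h a) i
    · choose s hs using fun i => (IsStrictSegal.segal (X := X) n).surjective
        { vertex := fun a => P.vertex a i
          arrow := fun a => P.arrow a i
          arrow_src := fun a => congrFun (P.arrow_src a) i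
          arrow_tgt := fun a => congrFun (P.arrow_tgt a) i }
      refine ⟨s, SSet.Path.ext (funext fun a => funext fun i => ?_)
        (funext fun a => funext fun i => ?_)⟩
      · exact Path.congr_vertex (hs i) a
      · exact Path.congr_arrow (hs i) a

instance (ι : Type) (X : SSet.{0}) [HasInverses X] : HasInverses ((powFunctor ι).obj X) where
  exists_triangle e := by
    choose s h using fun i => HasInverses.exists_triangle X (e i)
    exact ⟨s, funext fun i => (h i).1, funext fun i => (h i).2⟩

/-! ### Telescopes, level by level -/

lemma ofSequence_map_app {M : GammaSpace} (f : M ⟶ M) (I : FinStar) (k m : ℕ) :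
    ((Functor.ofSequence fun _ : ℕ => f).map (homOfLE (Nat.le_add_right k m))).app I =
      iter (f.app I) m := by
  induction m with
  | zero =>
    have : homOfLE (Nat.le_add_right k 0) = 𝟙 k := rfl
    rw [this, CategoryTheory.Functor.map_id]
    rfl
  | succ m ih =>
    have : homOfLE (Nat.le_add_right k (m + 1)) =
      homOfLE (Nat.le_add_right k m) ≫ homOfLE (Nat.le_add_right (k + m) 1) := rfl
    rw [this, Functor.map_comp, NatTrans.comp_app, ih]
    exact congrArg (fun q : M ⟶ M => iter (f.app I) m ≫ q.app I)
      (Functor.ofSequence_map_homOfLE_succ (fun _ : ℕ => f) (k + m))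

section

variable {p : ℕ} {M : GammaSpace} {hM : IsSpecial M} (φ : StrictFrobenius p M hM)

/-- The map from the `k`-th stage to the telescope. -/
noncomputable def stage (k : ℕ) : M ⟶ telescope φ :=
  colimit.ι (Functor.ofSequence fun _ : ℕ => φ.map) k

lemma map_stage (k : ℕ) : φ.map ≫ stage φ (k + 1) = stage φ k := by
  have := colimit.w (Functor.ofSequence fun _ : ℕ => φ.map) (homOfLE k.le_succ)
  rwa [Functor.ofSequence_map_homOfLE_succ] at this

/-- Telescopes are computed levelwise. -/
lemma isTel_telescope (I : FinStar) : IsTel (φ.map.app I) fun k => (stage φ k).app I where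
  comp k := congrArg (fun q => q.app I) (map_stage φ k)
  surj {n} x :=
    Types.jointly_surjective _ (isColimitOfPreserves
      ((evaluation FinStar SSet.{0}).obj I ⋙ (evaluation SimplexCategoryᵒᵖ Type).obj n)
        (colimit.isColimit (Functor.ofSequence fun _ : ℕ => φ.map))) x
  eq {n k y y'} h := by
    obtain ⟨k', f, hf⟩ := (Limits.Types.FilteredColimit.isColimit_eq_iff' (isColimitOfPreserves
      ((evaluation FinStar SSet.{0}).obj I ⋙ (evaluation SimplexCategoryᵒᵖ Type).obj n)
        (colimit.isColimit (Functor.ofSequence fun _ : ℕ => φ.map))) y y').1 h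
    obtain ⟨m, rfl⟩ := Nat.exists_eq_add_of_le (leOfHom f)
    refine ⟨m, ?_⟩
    rw [← ofSequence_map_app φ.map I k m]
    exact hf

end

section

variable {p : ℕ} (φ : StrictFrobenius p finGamma isSpecial_finGamma)

instance (I : FinStar) : ((telescope φ).obj I).IsStrictSegal :=
  have : (finGamma.obj I).IsStrictSegal :=
    inferInstanceAs (nerve (LabeledSet I)).IsStrictSegal
  (isTel_telescope φ I).isStrictSegal

instance (I : FinStar) : HasInverses ((telescope φ).obj I) :=
  have : HasInverses (finGamma.obj I) := inferInstanceAs (HasInverses (nerve (LabeledSet I)))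
  (isTel_telescope φ I).hasInverses

lemma isEdgeEquiv_segalMap_finGamma (I : FinStar) : IsEdgeEquiv (segalMap finGamma I) :=
  have : IsGroupoid (I.carrier → LabeledSet .pt) := inferInstance
  (isEdgeEquiv_nerveMap (LabeledSet.fibres I)).comp_iso (nervePow I.carrier (LabeledSet .pt))

lemma segalMap_naturality {X Y : GammaSpace} (f : X ⟶ Y) (I : FinStar) :
    f.app I ≫ segalMap Y I = segalMap X I ≫ (powFunctor I.carrier).map (f.app .pt) := by
  ext n x
  funext i
  exact (congrArg (fun q : X.obj I ⟶ Y.obj .pt => q.app n x) (f.naturality (FinStar.proj i))).symm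

/-- The telescope of the groupoid of finite sets is a commutative monoid. -/
lemma isSpecial_telescope : IsSpecial (telescope φ) := fun I =>
  -- The Segal map of the telescope is the sequential colimit of the Segal maps of `finGamma`,
  -- because the finite power on the right commutes with that colimit.
  ((isTel_telescope φ I).isEdgeEquiv ((isTel_telescope φ .pt).pow I.carrier)
    (segalMap_naturality φ.map I) (fun k => segalMap_naturality (stage φ k) I)
    (isEdgeEquiv_segalMap_finGamma I)).weakEq

end

/-! ### The homotopy category and naturality of the Frobenius map -/

/-- Homotopy classes of maps to `K`. -/
def hoClassFunctor (K : SSet.{0}) : SSet.{0} ⥤ Type ᵒᵖ where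
  obj X := op (HoClass X K)
  map f := (↾HoClass.precomp f K : HoClass _ K ⟶ HoClass _ K).op
  map_id X := by
    refine congrArg Quiver.Hom.op ?_
    ext x
    induction x using Quot.ind
    rfl
  map_comp f g := by
    refine congrArg Quiver.Hom.op ?_
    ext x
    exact congrFun (precomp_comp f g K) x

lemma isIso_hoClassFunctor_map_iff {X Y : SSet.{0}} (f : X ⟶ Y) (K : SSet.{0}) :
    IsIso ((hoClassFunctor K).map f) ↔ Function.Bijective (HoClass.precomp f K) := by
  rw [← isIso_unop_iff, isIso_iff_bijective]
  rfl

lemma HoEq.hoClassFunctor_map_eq {X Y : SSet.{0}} {f g : X ⟶ Y} (h : HoEq f g) (K : SSet.{0}) :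
    (hoClassFunctor K).map f = (hoClassFunctor K).map g := by
  refine congrArg Quiver.Hom.op ?_
  ext x
  induction x using Quot.ind with | mk x
  exact (mk_eq_iff _ _).2 (h.postcomp x)

lemma lift_map_toHo {D : Type*} [Category D] (G : GammaSpace ⥤ D) (hG : levelwiseWeakEq.IsInvertedBy G)
    {X Y : GammaSpace} (f : X ⟶ Y) :
    (Localization.Construction.lift G hG).map (toHo.map f) = G.map f := by
  have := CategoryTheory.Functor.congr_hom (Localization.Construction.fac G hG) f
  exact this.trans ((Category.id_comp _).trans (Category.comp_id _))

/-- Homotopy classes of maps from the underlying space to a Kan complex, as a functor on the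
homotopy category. -/
noncomputable def hoUnderlying (K : SSet.{0}) (hK : SSet.KanComplex K) : HoGamma ⥤ Type ᵒᵖ :=
  Localization.Construction.lift ((evaluation FinStar SSet.{0}).obj .pt ⋙ hoClassFunctor K)
    fun _ _ _ hf => (isIso_hoClassFunctor_map_iff _ K).2 (hf .pt K hK)

lemma hoUnderlying_map {K : SSet.{0}} (hK : SSet.KanComplex K) {X Y : GammaSpace} (f : X ⟶ Y) :
    (hoUnderlying K hK).map (toHo.map f) = (hoClassFunctor K).map (f.app .pt) :=
  lift_map_toHo _ _ f

/-- A Yoneda argument: homotopy classes of maps into the Kan complex underlying `Y` form a functor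
on the homotopy category, and it is evaluated on the class of the identity. -/
lemma hoEq_of_toHo_map_eq {X Y : GammaSpace} {f g : X ⟶ Y} (h : toHo.map f = toHo.map g)
    (hY : SSet.KanComplex (Y.obj .pt)) : HoEq (f.app .pt) (g.app .pt) := by
  have := congrArg (hoUnderlying _ hY).map h
  rw [hoUnderlying_map, hoUnderlying_map] at this
  have := congrArg (fun q => q.unop (HoClass.mk (𝟙 (Y.obj .pt)))) this
  exact (mk_eq_iff _ _).1 this

/-- The functor `X ↦ X ^ p` on the homotopy category. -/
noncomputable def hoPower (p : ℕ) : HoGamma ⥤ HoGamma :=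
  Localization.Construction.lift ((Functor.whiskeringRight _ _ _).obj (powFunctor (Fin p)) ⋙ toHo)
    fun _ _ _ hf => Localization.inverts toHo levelwiseWeakEq _ fun I => weakEq_pow _ (hf I)

/-- The functor `X ↦ X({1, …, p}₊ ∧ -)` on the homotopy category. -/
noncomputable def hoSmash (p : ℕ) : HoGamma ⥤ HoGamma :=
  Localization.Construction.lift ((Functor.whiskeringLeft _ _ _).obj (FinStar.smash p) ⋙ toHo)
    fun _ _ _ hf => Localization.inverts toHo levelwiseWeakEq _ fun _ => hf _

/-- Naturality for maps of Γ-spaces implies naturality for maps in the homotopy category. -/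
lemma natTrans_naturality {F G : HoGamma ⥤ HoGamma} (τ : toHo ⋙ F ⟶ toHo ⋙ G) {X Y : GammaSpace}
    (c : toHo.obj X ⟶ toHo.obj Y) : F.map c ≫ τ.app Y = τ.app X ≫ G.map c := by
  have := (Localization.Construction.natTransExtension τ).naturality c
  exact (congrArg (F.map c ≫ ·) (Localization.Construction.NatTransExtension.app_eq τ Y)).symm.trans
    (this.trans (congrArg (· ≫ G.map c) (Localization.Construction.NatTransExtension.app_eq τ X)))

variable (p : ℕ)

lemma hoPower_map {X Y : GammaSpace} (f : X ⟶ Y) :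
    (hoPower p).map (toHo.map f) = toHo.map (Functor.whiskerRight f (powFunctor (Fin p))) :=
  lift_map_toHo _ _ f

lemma hoSmash_map {X Y : GammaSpace} (f : X ⟶ Y) :
    (hoSmash p).map (toHo.map f) = toHo.map (Functor.whiskerLeft (FinStar.smash p) f) :=
  lift_map_toHo _ _ f

/-- A morphism of the homotopy category is a zigzag, so strict naturality has to be extended over
the localization; the same holds for `smashSegal` and `foldMap`. -/
lemma diagonal_naturality {X Y : GammaSpace} (c : toHo.obj X ⟶ toHo.obj Y) :
    c ≫ toHo.map (diagonal p Y) = toHo.map (diagonal p X) ≫ (hoPower p).map c :=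
  natTrans_naturality (F := 𝟭 _) (G := hoPower p)
    { app := fun X => toHo.map (diagonal p X)
      naturality := fun X Y f => by
        refine Eq.trans ?_ (congrArg (toHo.map (diagonal p X) ≫ ·) (hoPower_map p f)).symm
        exact (toHo.map_comp f (diagonal p Y)).symm.trans (toHo.map_comp (diagonal p X)
          (Functor.whiskerRight f (powFunctor (Fin p)) : power p X ⟶ power p Y)) } c

lemma smashSegal_naturality {X Y : GammaSpace} (c : toHo.obj X ⟶ toHo.obj Y) :
    (hoSmash p).map c ≫ toHo.map (smashSegal p Y) =
      toHo.map (smashSegal p X) ≫ (hoPower p).map c :=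
  natTrans_naturality (F := hoSmash p) (G := hoPower p)
    { app := fun X => toHo.map (smashSegal p X)
      naturality := fun X Y f => by
        refine Eq.trans (congrArg (· ≫ toHo.map (smashSegal p Y)) (hoSmash_map p f)) ?_
        refine Eq.trans ?_ (congrArg (toHo.map (smashSegal p X) ≫ ·) (hoPower_map p f)).symm
        refine (toHo.map_comp _ (smashSegal p Y)).symm.trans
          (Eq.trans ?_ (toHo.map_comp (smashSegal p X) _))
        refine congrArg toHo.map ?_
        ext I n x
        funext k
        exact congrArg (fun q : X.obj _ ⟶ Y.obj _ => q.app n x)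
          (f.naturality ((FinStar.smashProj p k).app I)).symm } c

lemma foldMap_naturality {X Y : GammaSpace} (c : toHo.obj X ⟶ toHo.obj Y) :
    (hoSmash p).map c ≫ toHo.map (foldMap p Y) = toHo.map (foldMap p X) ≫ c :=
  natTrans_naturality (F := hoSmash p) (G := 𝟭 _)
    { app := fun X => toHo.map (foldMap p X)
      naturality := fun X Y f => by
        refine Eq.trans (congrArg (· ≫ toHo.map (foldMap p Y)) (hoSmash_map p f)) ?_
        refine (toHo.map_comp _ (foldMap p Y)).symm.trans
          (Eq.trans ?_ (toHo.map_comp (foldMap p X) f))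
        refine congrArg toHo.map ?_
        ext I n x
        exact congrArg (fun q : X.obj _ ⟶ Y.obj _ => q.app n x)
          (f.naturality ((FinStar.smashFold p).app I)).symm } c

/-- The Frobenius map is natural. -/
lemma frobenius_naturality {X Y : GammaSpace} (hX : IsSpecial X) (hY : IsSpecial Y)
    (c : toHo.obj X ⟶ toHo.obj Y) : c ≫ frobenius p Y hY = frobenius p X hX ≫ c := by
  -- The values of `hoPower` and `hoSmash` are `toHo` of power and smash only up to unfolding; the
  -- existential gives `c₁` and `c₂` the types needed for rewriting.
  obtain ⟨c₁, c₂, h₁, h₂, h₃⟩ : ∃ (c₁ : toHo.obj (power p X) ⟶ toHo.obj (power p Y))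
      (c₂ : toHo.obj (FinStar.smash p ⋙ X) ⟶ toHo.obj (FinStar.smash p ⋙ Y)),
      c ≫ toHo.map (diagonal p Y) = toHo.map (diagonal p X) ≫ c₁ ∧
      c₂ ≫ toHo.map (smashSegal p Y) = toHo.map (smashSegal p X) ≫ c₁ ∧
      c₂ ≫ toHo.map (foldMap p Y) = toHo.map (foldMap p X) ≫ c :=
    ⟨(hoPower p).map c, (hoSmash p).map c, diagonal_naturality p c, smashSegal_naturality p c,
      foldMap_naturality p c⟩
  let sX := Localization.isoOfHom toHo levelwiseWeakEq (smashSegal p X) (smashSegal_weakEq p hX)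
  let sY := Localization.isoOfHom toHo levelwiseWeakEq (smashSegal p Y) (smashSegal_weakEq p hY)
  have h : c₁ ≫ sY.inv = sX.inv ≫ c₂ := by
    rw [Iso.comp_inv_eq, Category.assoc, Iso.eq_inv_comp]
    exact h₂.symm
  change c ≫ toHo.map (diagonal p Y) ≫ sY.inv ≫ toHo.map (foldMap p Y) =
    (toHo.map (diagonal p X) ≫ sX.inv ≫ toHo.map (foldMap p X)) ≫ c
  rw [Category.assoc, Category.assoc, ← h₃, reassoc_of% h₁, reassoc_of% h]

/-- By naturality the two Frobenius maps are conjugate under `c`. -/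
lemma isPPerfect_of_iso {X Y : GammaSpace} (hX : IsSpecial X) (c : toHo.obj X ≅ toHo.obj Y)
    (hY : IsPPerfect p Y) : IsPPerfect p X := by
  obtain ⟨hY, h⟩ := hY
  refine ⟨hX, ?_⟩
  have : frobenius p X hX = c.hom ≫ frobenius p Y hY ≫ c.inv := by
    rw [← Category.assoc, frobenius_naturality p hX hY, Category.assoc, Iso.hom_inv_id,
      Category.comp_id]
  rw [this]
  infer_instance

/-! ### Permutations of finite sets and multiplication by `p` -/

namespace LabeledSet

lemma eq_of_lab_ne_none {a b : LabeledSet .pt} (x : a.supp) (y : b.supp) :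
    b.lab y.1 = a.lab x.1 := by
  obtain ⟨⟨⟩, hu⟩ := Option.ne_none_iff_exists'.1 x.2
  obtain ⟨⟨⟩, hv⟩ := Option.ne_none_iff_exists'.1 y.2
  rw [hu, hv]

/-- The automorphism given by a permutation. -/
def ofPerm {a : LabeledSet .pt} (e : Equiv.Perm a.supp) : a ⟶ a :=
  ⟨e, fun _ => eq_of_lab_ne_none _ _⟩

/-- Permutations act faithfully by automorphisms. -/
def permAut (a : LabeledSet .pt) : Equiv.Perm a.supp →* Aut a where
  toFun e := ⟨ofPerm e, ofPerm e⁻¹, by apply hom_ext; intro x; exact congrArg Subtype.val (e.symm_apply_apply x),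
    by apply hom_ext; intro x; exact congrArg Subtype.val (e.apply_symm_apply x)⟩
  map_one' := rfl
  map_mul' _ _ := rfl

lemma permAut_injective (a : LabeledSet .pt) : Function.Injective (permAut a) := fun _ _ h =>
  congrArg (fun q : Aut a => q.hom.equiv) h

/-- If `g` moves `x` and `z` is a third point, the transposition of `g x` and `z` fixes `x` but
moves `g x`, so it does not commute with `g`. -/
lemma exists_not_comm {a : LabeledSet .pt} (ha : 3 ≤ Nat.card a.supp) {g : a ⟶ a} (hg : g ≠ 𝟙 a) :
    ∃ h : a ⟶ a, g ≫ h ≠ h ≫ g := by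
  classical
  obtain ⟨x, hx⟩ : ∃ x, g.equiv x ≠ x := by
    by_contra! h
    exact hg (hom_ext fun x => congrArg Subtype.val (h x))
  obtain ⟨z, hz⟩ : ∃ z, z ∉ ({x, g.equiv x} : Finset a.supp) := by
    by_contra! h
    have := (Finset.card_le_card fun z (_ : z ∈ Finset.univ) => h z).trans Finset.card_le_two
    rw [Finset.card_univ, ← Nat.card_eq_fintype_card] at this
    exact absurd (ha.trans this) (by decide)
  simp only [Finset.mem_insert, Finset.mem_singleton, not_or] at hz
  refine ⟨ofPerm (Equiv.swap (g.equiv x) z), fun h => ?_⟩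
  have : Equiv.swap (g.equiv x) z (g.equiv x) = g.equiv (Equiv.swap (g.equiv x) z x) :=
    congrArg (fun q : a ⟶ a => q.equiv x) h
  rw [Equiv.swap_apply_left, Equiv.swap_apply_of_ne_of_ne hx.symm (Ne.symm hz.1)] at this
  exact hz.2 this

lemma exists_ne_id {a : LabeledSet .pt} (ha : 2 ≤ Nat.card a.supp) : ∃ g : a ⟶ a, g ≠ 𝟙 a := by
  classical
  have : Nontrivial a.supp := Finite.one_lt_card_iff_nontrivial.1 ha
  obtain ⟨x, y, hxy⟩ := exists_pair_ne a.supp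
  refine ⟨ofPerm (Equiv.swap x y), fun h => hxy ?_⟩
  have : Equiv.swap x y x = x := congrArg (fun q : a ⟶ a => q.equiv x) h
  rw [Equiv.swap_apply_left] at this
  exact this.symm

lemma card_eq_of_iso {a b : LabeledSet .pt} (e : a ≅ b) : Nat.card a.supp = Nat.card b.supp :=
  Nat.card_congr e.hom.equiv

/-- The functor `A ↦ A × {1, …, p}`. -/
abbrev times (p : ℕ) : LabeledSet .pt ⥤ LabeledSet .pt :=
  copies p .pt ⋙ push ((FinStar.smashFold p).app .pt)

variable {p : ℕ}

lemma times_lab (a : LabeledSet .pt) (z : Fin (a.card * p)) :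
    ((times p).obj a).lab z = a.lab (finProdFinEquiv.symm z).1 := by
  change ((a.lab (finProdFinEquiv.symm z).1).map fun x => ((finProdFinEquiv.symm z).2, x)).map
    Prod.snd = _
  cases a.lab (finProdFinEquiv.symm z).1 <;> rfl

lemma card_times (a : LabeledSet .pt) :
    Nat.card ((times p).obj a).supp = Nat.card a.supp * p := by
  rw [← Nat.card_fin p, ← Nat.card_prod, Nat.card_fin p]
  refine Nat.card_congr
    { toFun := fun z => (⟨(finProdFinEquiv.symm z.1).1, fun h => z.2 ((times_lab a z.1).trans h)⟩,
        (finProdFinEquiv.symm z.1).2)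
      invFun := fun x => ⟨finProdFinEquiv (x.1.1, x.2), by
        rw [times_lab, Equiv.symm_apply_apply]; exact x.1.2⟩
      left_inv := fun z => Subtype.ext (finProdFinEquiv.apply_symm_apply z.1)
      right_inv := fun x => by
        have h := finProdFinEquiv.symm_apply_apply (x.1.1, x.2)
        refine Prod.ext (Subtype.ext ?_) ?_
        · exact congrArg Prod.fst h
        · exact (congrArg Prod.snd h.symm).symm }

/-- A bijection can be read off from its effect on the copy with index `0`, which exists because `p`
is positive. -/
lemma faithful_times (hp : 0 < p) : (times p).Faithful where
  map_injective {a b e f} h := by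
    apply hom_ext
    intro x
    let z : ((times p).obj a).supp := ⟨finProdFinEquiv (x.1, ⟨0, hp⟩), by
      rw [times_lab, Equiv.symm_apply_apply]; exact x.2⟩
    have key (e : a ⟶ b) : (((times p).map e).equiv z).1 =
        finProdFinEquiv ((e.equiv x).1, ⟨0, hp⟩) := by
      have h := finProdFinEquiv.symm_apply_apply (x.1, (⟨0, hp⟩ : Fin p))
      refine congrArg finProdFinEquiv (Prod.ext ?_ ?_)
      · exact congrArg (fun y : a.supp => (e.equiv y).1) (Subtype.ext (congrArg Prod.fst h))
      · exact (congrArg Prod.snd h.symm).symm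
    have := (key e).symm.trans ((congrArg (fun q => (q.equiv z).1) h).trans (key f))
    exact congrArg Prod.fst (finProdFinEquiv.injective this)

end LabeledSet

/-- All strict representatives agree with `finFrobenius` in the homotopy category. As the nerve of a
groupoid is Kan, the underlying maps are homotopic, and homotopic functors between groupoids are
isomorphic. This makes the later arguments independent of `φ`. -/
lemma exists_functor_iso_times {p : ℕ} (φ : StrictFrobenius p finGamma isSpecial_finGamma) :
    ∃ Φ : LabeledSet .pt ⥤ LabeledSet .pt, nerveMap Φ = φ.map.app .pt ∧
      Nonempty (Φ ≅ LabeledSet.times p) := by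
  obtain ⟨Φ, hΦ⟩ := nerveMap_surjective (C := LabeledSet .pt) (D := LabeledSet .pt)
    (φ.map.app .pt)
  refine ⟨Φ, hΦ, ?_⟩
  apply iso_of_hoEq
  rw [hΦ]
  exact hoEq_of_toHo_map_eq (φ.isFrobenius.trans (finFrobenius p).isFrobenius.symm)
    (kanComplex_nerve (LabeledSet .pt))

/-- A functor whose nerve is a given representative of the Frobenius map. -/
noncomputable def frobFunctor {p : ℕ} (φ : StrictFrobenius p finGamma isSpecial_finGamma) :
    LabeledSet .pt ⥤ LabeledSet .pt :=
  (exists_functor_iso_times φ).choose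

section

variable {p : ℕ} (φ : StrictFrobenius p finGamma isSpecial_finGamma)

lemma nerveMap_frobFunctor : nerveMap (frobFunctor φ) = φ.map.app .pt :=
  (exists_functor_iso_times φ).choose_spec.1

lemma card_frobFunctor (a : LabeledSet .pt) :
    Nat.card ((frobFunctor φ).obj a).supp = Nat.card a.supp * p := by
  obtain ⟨e⟩ := (exists_functor_iso_times φ).choose_spec.2
  rw [← LabeledSet.card_times]
  exact LabeledSet.card_eq_of_iso (e.app a)

lemma faithful_frobFunctor (hp : 0 < p) : (frobFunctor φ).Faithful := by
  obtain ⟨e⟩ := (exists_functor_iso_times φ).choose_spec.2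
  have := LabeledSet.faithful_times hp
  exact Functor.Faithful.of_iso e.symm

/-- The `k`-th stage of the telescope, as a functor. -/
noncomputable def stageFunctor (I : FinStar) (k : ℕ) :
    LabeledSet I ⥤ EdgeCat ((telescope φ).obj I) :=
  EdgeCat.ofNerve (C := LabeledSet I) ((stage φ k).app I)

/-- This is a strict equality of functors: a set at one stage and its `p`-fold multiple at the next
are the same object of the telescope. -/
lemma stageFunctor_eq (k : ℕ) :
    stageFunctor φ .pt k = frobFunctor φ ⋙ stageFunctor φ .pt (k + 1) := by
  refine Eq.trans ?_ (EdgeCat.ofNerve_nerveMap (frobFunctor φ)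
    (X := (telescope φ).obj .pt) ((stage φ (k + 1)).app .pt))
  rw [nerveMap_frobFunctor]
  exact congrArg (fun q => EdgeCat.ofNerve (C := LabeledSet .pt) (q.app FinStar.pt))
    (map_stage φ k).symm

/-- Morphisms identified in the colimit are identified after finitely many applications of
`frobFunctor`, which is faithful. -/
lemma faithful_stageFunctor (hp : 0 < p) (k : ℕ) : (stageFunctor φ .pt k).Faithful where
  map_injective {a b u v} h := by
    have := faithful_frobFunctor φ hp
    obtain ⟨m, hm⟩ := (isTel_telescope φ .pt).eq (n := op ⦋1⦌) (k := k)
      (y := ComposableArrows.mk₁ u) (y' := ComposableArrows.mk₁ v)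
      (congrArg (Edge.edge (X := (telescope φ).obj .pt)) h)
    clear h
    induction m generalizing a b with
    | zero =>
      exact (Functor.congr_hom hm (homOfLE (show (0 : Fin 2) ≤ 1 by decide))).trans
        ((Category.id_comp _).trans (Category.comp_id _))
    | succ m ih =>
      refine (frobFunctor φ).map_injective (ih ?_)
      -- This splits off the first iteration instead of the last, so that the induction hypothesis
      -- applies to the images under `frobFunctor`.
      rw [add_comm, iter_add] at hm
      have key {a b : LabeledSet .pt} (u : a ⟶ b) : (φ.map.app .pt).app (op ⦋1⦌)
          (ComposableArrows.mk₁ u) = ComposableArrows.mk₁ ((frobFunctor φ).map u) := by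
        rw [← nerveMap_frobFunctor]
        exact ComposableArrows.ext₁ rfl rfl ((Category.id_comp _).trans (Category.comp_id _)).symm
      rw [← key, ← key]
      exact hm

end

/-- Suppose that `S` identifies `B` with families of objects of `A`, that `D` is the diagonal and
that `F` is an addition which is symmetric with respect to a permutation `t` of the families. If
the multiplication `D ⋙ R ⋙ F` by the number of members of the families is full, then the
automorphisms of multiples that permute the summands are central. -/
lemma permutation_central {A B Q ι : Type} [SmallCategory A] [SmallCategory B] [SmallCategory Q]
    (S : B ⥤ Q) [S.Full] [S.Faithful] (R : Q ⥤ B) (κ : R ⋙ S ≅ 𝟭 Q) (D : A ⥤ Q) (F : B ⥤ A)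
    [(D ⋙ R ⋙ F).Full]
    (E : ι → (Q ⥤ A)) (hE : ∀ {x y : Q} (u v : x ⟶ y), (∀ k, (E k).map u = (E k).map v) → u = v)
    (ζ : ∀ k, D ⋙ E k ≅ 𝟭 A) (π : ι → ι) (t : B ⥤ B) (σ : ∀ k, t ⋙ S ⋙ E k ≅ S ⋙ E (π k))
    (ψ : t ⋙ F ≅ F) {y : B} {a : A} (ε : S.obj y ≅ D.obj a) (θ : t.obj y ⟶ y)
    (hθ : ∀ k, (E k).map (S.map θ) = (σ k).hom.app y ≫ (E (π k)).map ε.hom ≫ (ζ (π k)).hom.app a ≫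
      (ζ k).inv.app a ≫ (E k).map ε.inv) (w : F.obj y ⟶ F.obj y) :
    (ψ.inv.app y ≫ F.map θ) ≫ w = w ≫ ψ.inv.app y ≫ F.map θ := by
  let e : y ≅ R.obj (D.obj a) := S.preimageIso (ε ≪≫ (κ.app (D.obj a)).symm)
  -- Fullness enters here: up to conjugation by `e`, the given `w` is the sum of copies of one
  -- endomorphism `h` of `a`.
  obtain ⟨h, hh⟩ := (D ⋙ R ⋙ F).map_surjective (F.map e.inv ≫ w ≫ F.map e.hom)
  let h' : y ⟶ y := e.hom ≫ R.map (D.map h) ≫ e.inv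
  have hw : F.map h' = w := by
    have : F.map (R.map (D.map h)) = F.map e.inv ≫ w ≫ F.map e.hom := hh
    simp only [h', Functor.map_comp, this, Category.assoc]
    simp only [← Functor.map_comp_assoc, ← Functor.map_comp, Iso.hom_inv_id, CategoryTheory.Functor.map_id,
      Category.id_comp, Category.comp_id]
  have hS : S.map h' = ε.hom ≫ D.map h ≫ ε.inv := by
    have := κ.hom.naturality (D.map h)
    have h₁ : S.map e.hom = ε.hom ≫ κ.inv.app _ := S.map_preimage _
    have h₂ : S.map e.inv = κ.hom.app _ ≫ ε.inv := S.map_preimage _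
    change S.map (R.map (D.map h)) ≫ κ.hom.app _ = κ.hom.app _ ≫ D.map h at this
    simp only [h', Functor.map_comp, h₁, h₂, Category.assoc]
    rw [reassoc_of% this]
    exact congrArg (ε.hom ≫ ·) (κ.inv_hom_id_app_assoc _ _)
  have hζ (k : ι) : (E k).map (D.map h) = (ζ k).hom.app a ≫ h ≫ (ζ k).inv.app a := by
    have := (ζ k).hom.naturality h
    change (E k).map (D.map h) ≫ (ζ k).hom.app a = (ζ k).hom.app a ≫ h at this
    rw [← reassoc_of% this, Iso.hom_inv_id_app]
    exact (Category.comp_id _).symm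
  -- Every component of `h'` is, up to the chosen isomorphisms, the same `h`, so `h'` is compatible
  -- with permuting the components.
  have key : t.map h' ≫ θ = θ ≫ h' := by
    apply S.map_injective
    apply hE
    intro k
    have hσ := (σ k).hom.naturality h'
    change (E k).map (S.map (t.map h')) ≫ _ = _ ≫ (E (π k)).map (S.map h') at hσ
    simp only [Functor.map_comp, hθ, hS, hζ, Category.assoc] at hσ ⊢
    rw [reassoc_of% hσ]
    simp only [← Functor.map_comp_assoc, Iso.inv_hom_id, CategoryTheory.Functor.map_id, Category.id_comp,
      Iso.inv_hom_id_app_assoc]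
  have hψ := ψ.inv.naturality h'
  change F.map h' ≫ ψ.inv.app y = ψ.inv.app y ≫ F.map (t.map h') at hψ
  rw [← hw, reassoc_of% hψ, Category.assoc, ← Functor.map_comp, ← Functor.map_comp, key]

/-! ### Permuting summands -/

namespace FinStar

/-- Permutation of the copies of `I`. -/
def smashPerm {p : ℕ} (π : Equiv.Perm (Fin p)) (I : FinStar) : (smash p).obj I ⟶ (smash p).obj I :=
  ⟨fun x => x.map fun y => (π y.1, y.2), rfl⟩

variable {p : ℕ} (π : Equiv.Perm (Fin p)) (I : FinStar)

lemma smashPerm_fold : smashPerm π I ≫ (smashFold p).app I = (smashFold p).app I := by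
  ext1 x
  cases x <;> rfl

/-- The inverse appears because the copy arriving in position `k` started in position `π⁻¹ k`. -/
lemma smashPerm_proj (k : Fin p) :
    smashPerm π I ≫ (smashProj p k).app I = (smashProj p (π.symm k)).app I := by
  ext1 x
  rcases x with _ | ⟨j, y⟩
  · rfl
  · change (if π j = k then some y else none) = if j = π.symm k then some y else none
    simp only [Equiv.eq_symm_apply]

end FinStar

/-- The projections of a power. -/
def powEval (ι : Type) (X : SSet.{0}) (i : ι) : (powFunctor ι).obj X ⟶ X where
  app n := ↾fun s => s i
  naturality := by intros; rfl

namespace EdgeCat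

variable {ι : Type} {X : SSet.{0}} [X.IsStrictSegal]

/-- A morphism in the category of edges of a power, from its components. -/
noncomputable def piHom {x y : EdgeCat ((powFunctor ι).obj X)}
    (c : ∀ i, (map (powEval ι X i)).obj x ⟶ (map (powEval ι X i)).obj y) : x ⟶ y :=
  Edge.mk (X := (powFunctor ι).obj X) (fun i => Edge.edge (X := X) (c i))
    (funext fun i => Edge.src_eq (X := X) (c i)) (funext fun i => Edge.tgt_eq (X := X) (c i))

lemma map_piHom {x y : EdgeCat ((powFunctor ι).obj X)}
    (c : ∀ i, (map (powEval ι X i)).obj x ⟶ (map (powEval ι X i)).obj y) (i : ι) :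
    (map (powEval ι X i)).map (piHom c) = c i := rfl

lemma pi_ext {x y : EdgeCat ((powFunctor ι).obj X)} (u v : x ⟶ y)
    (h : ∀ i, (map (powEval ι X i)).map u = (map (powEval ι X i)).map v) : u = v :=
  Edge.ext (funext fun i => congrArg (Edge.edge (X := X)) (h i))

/-- An isomorphism in the category of edges of a power, from its components. -/
noncomputable def piIso {x y : EdgeCat ((powFunctor ι).obj X)}
    (c : ∀ i, (map (powEval ι X i)).obj x ≅ (map (powEval ι X i)).obj y) : x ≅ y where
  hom := piHom fun i => (c i).hom
  inv := piHom fun i => (c i).inv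
  hom_inv_id := pi_ext _ _ fun i => by
    rw [Functor.map_comp, map_piHom, map_piHom, Iso.hom_inv_id, CategoryTheory.Functor.map_id]
  inv_hom_id := pi_ext _ _ fun i => by
    rw [Functor.map_comp, map_piHom, map_piHom, Iso.inv_hom_id, CategoryTheory.Functor.map_id]

end EdgeCat

/-- If a zigzag `d`, `s`, `f` is an equivalence, then so is the corresponding functor between
categories of edges. -/
lemma isEquivalence_of_zigzag {X W Q : SSet.{0}} [X.IsStrictSegal] [W.IsStrictSegal]
    [Q.IsStrictSegal] [HasInverses X] [HasInverses W] [HasInverses Q] (d : X ⟶ Q) (s : W ⟶ Q)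
    (f : W ⟶ X) (R : EdgeCat Q ⥤ EdgeCat W) (κ : R ⋙ EdgeCat.map s ≅ 𝟭 _)
    (h : ∀ K : SSet.{0}, SSet.KanComplex K →
      ∃ i : (hoClassFunctor K).obj Q ⟶ (hoClassFunctor K).obj W,
        (hoClassFunctor K).map s ≫ i = 𝟙 _ ∧
        IsIso ((hoClassFunctor K).map d ≫ i ≫ (hoClassFunctor K).map f)) :
    (EdgeCat.map d ⋙ R ⋙ EdgeCat.map f).IsEquivalence := by
  apply isEquivalence_of_weakEq
  intro K hK
  obtain ⟨i, hi, hdf⟩ := h K hK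
  rw [← isIso_hoClassFunctor_map_iff]
  let r : Q ⟶ W := EdgeCat.toNerve Q ≫ nerveMap R ≫ inv (EdgeCat.toNerve W)
  -- On homotopy classes `r` is a left inverse and `i` a right inverse of the same map, that of `s`,
  -- so they coincide. Thus the inverse functor `R` realizes the abstract inverse `i`.
  have hr : (hoClassFunctor K).map r = i := by
    have hs : r ≫ s = EdgeCat.toNerve Q ≫ nerveMap (R ⋙ EdgeCat.map s) ≫
        inv (EdgeCat.toNerve Q) := by
      have : inv (EdgeCat.toNerve W) ≫ s = nerveMap (EdgeCat.map s) ≫ inv (EdgeCat.toNerve Q) := by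
        rw [IsIso.inv_comp_eq, ← Category.assoc, IsIso.eq_comp_inv, EdgeCat.toNerve_naturality]
      simp only [r, Category.assoc, this]
      rfl
    have hs' : (hoClassFunctor K).map (r ≫ s) = 𝟙 _ := by
      rw [hs, Functor.map_comp, Functor.map_comp, (hoEq_nerveMap κ).hoClassFunctor_map_eq K,
        ← Functor.map_comp, ← Functor.map_comp]
      refine Eq.trans (congrArg (hoClassFunctor K).map ?_) ((hoClassFunctor K).map_id Q)
      exact (congrArg (EdgeCat.toNerve Q ≫ ·) (Category.id_comp _)).trans (IsIso.hom_inv_id _)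
    rw [← Category.comp_id ((hoClassFunctor K).map r), ← hi, ← Category.assoc, ← Functor.map_comp,
      hs', Category.id_comp]
  have : nerveMap (EdgeCat.map d ⋙ R ⋙ EdgeCat.map f) =
      inv (EdgeCat.toNerve X) ≫ (d ≫ r ≫ f) ≫ EdgeCat.toNerve X := by
    rw [IsIso.eq_inv_comp]
    simp only [r, Category.assoc, EdgeCat.toNerve_naturality, IsIso.inv_hom_id_assoc]
    rw [reassoc_of% EdgeCat.toNerve_naturality d]
    rfl
  rw [this, Functor.map_comp, Functor.map_comp, Functor.map_comp, Functor.map_comp, hr]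
  infer_instance

/-- For a `p`-perfect monoid, multiplication by `p` is an equivalence of underlying spaces. -/
lemma exists_isIso_of_isPPerfect {p : ℕ} {X : GammaSpace} (h : IsPPerfect p X) (K : SSet.{0})
    (hK : SSet.KanComplex K) :
    ∃ i : (hoClassFunctor K).obj ((power p X).obj .pt) ⟶
        (hoClassFunctor K).obj ((FinStar.smash p ⋙ X).obj .pt),
      (hoClassFunctor K).map ((smashSegal p X).app .pt) ≫ i = 𝟙 _ ∧
      IsIso ((hoClassFunctor K).map ((diagonal p X).app .pt) ≫ i ≫
        (hoClassFunctor K).map ((foldMap p X).app .pt)) := by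
  obtain ⟨hX, h⟩ := h
  let e := Localization.isoOfHom toHo levelwiseWeakEq (smashSegal p X) (smashSegal_weakEq p hX)
  refine ⟨(hoUnderlying K hK).map e.inv, ?_, ?_⟩
  · refine (congrArg (· ≫ (hoUnderlying K hK).map e.inv)
      (hoUnderlying_map hK (smashSegal p X)).symm).trans ?_
    refine ((hoUnderlying K hK).map_comp _ _).symm.trans ?_
    exact (congrArg (hoUnderlying K hK).map e.hom_inv_id).trans ((hoUnderlying K hK).map_id _)
  · have : IsIso ((hoUnderlying K hK).map (frobenius p X hX)) := inferInstance
    have key : (hoUnderlying K hK).map (frobenius p X hX) =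
        (hoUnderlying K hK).map (toHo.map (diagonal p X)) ≫ (hoUnderlying K hK).map e.inv ≫
          (hoUnderlying K hK).map (toHo.map (foldMap p X)) := by
      rw [← Functor.map_comp, ← Functor.map_comp]
      rfl
    rw [key, hoUnderlying_map, hoUnderlying_map] at this
    exact this

section

variable {p : ℕ} (φ : StrictFrobenius p finGamma isSpecial_finGamma)

lemma stageFunctor_naturality {I J : FinStar} (f : I ⟶ J) (k : ℕ) :
    stageFunctor φ I k ⋙ EdgeCat.map ((telescope φ).map f) =
      LabeledSet.push f ⋙ stageFunctor φ J k := by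
  refine Eq.trans ?_ (EdgeCat.ofNerve_nerveMap (LabeledSet.push f)
    (X := (telescope φ).obj J) ((stage φ k).app J))
  exact congrArg (EdgeCat.ofNerve (C := LabeledSet I) (X := (telescope φ).obj J))
    ((stage φ k).naturality f).symm

end

lemma eqToHom_comp_map {C A : Type} [SmallCategory C] [SmallCategory A] (J : C ⥤ A) {x : A}
    {b b' c : C} (hb : b = b') (h : x = J.obj b) (h' : x = J.obj b') (u : b ⟶ c) (v : b' ⟶ c)
    (huv : u = eqToHom hb ≫ v) : eqToHom h ≫ J.map u = eqToHom h' ≫ J.map v := by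
  subst hb
  simp [huv]

namespace LabeledSet

/-- The one-element set. -/
abbrev one : LabeledSet .pt := ⟨1, fun _ => some ()⟩

/-- Maps into a one-element set agree automatically, which settles the compatibility of the copy
isomorphisms with permutations of the copies. -/
lemma hom_one_ext {a : LabeledSet .pt} (u v : a ⟶ one) : u = v :=
  hom_ext fun _ => Subsingleton.elim (α := Fin 1) _ _

lemma card_one : Nat.card one.supp = 1 := by
  refine (Nat.card_congr (Equiv.subtypeUnivEquiv fun _ => Option.some_ne_none ())).trans ?_
  exact Nat.card_fin 1

/-- The permutation of the labels of `{1} × {1, …, p}`, as a permutation of the elements. -/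
def permCopies {p : ℕ} (π : Equiv.Perm (Fin p)) :
    (push (FinStar.smashPerm π .pt)).obj ((copies p .pt).obj one) ⟶ (copies p .pt).obj one where
  equiv := (finProdFinEquiv.permCongr ((Equiv.refl (Fin 1)).prodCongr π)).subtypeEquiv
    fun _ => ⟨fun _ => Option.some_ne_none _, fun _ => Option.some_ne_none _⟩
  lab_equiv x := by
    refine congrArg some (Prod.ext ?_ rfl)
    refine (congrArg Prod.snd (finProdFinEquiv.symm_apply_apply _).symm).symm

/-- The permutation of the elements of `{1} × {1, …, p}` induced by a permutation of
`{1, …, p}`. -/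
def permTimes {p : ℕ} (π : Equiv.Perm (Fin p)) : (times p).obj one ⟶ (times p).obj one :=
  (push ((FinStar.smashFold p).app .pt)).map
    (X := (push (FinStar.smashPerm π .pt)).obj ((copies p .pt).obj one)) (permCopies π)

/-- The value `π i` is recovered from the image of the element `(0, i)`. -/
lemma permTimes_ne_id {p : ℕ} {π : Equiv.Perm (Fin p)} (h : π ≠ 1) : permTimes π ≠ 𝟙 _ := by
  intro h'
  refine h (Equiv.ext fun i => ?_)
  have := congrArg (fun q : (times p).obj one ⟶ (times p).obj one =>
    (q.equiv ⟨finProdFinEquiv ((0 : Fin 1), i), Option.some_ne_none _⟩).1) h'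
  have := finProdFinEquiv.injective this
  have h₂ := congrArg Prod.snd this
  have h₃ := congrArg (fun q => π q.2) (finProdFinEquiv.symm_apply_apply ((0 : Fin 1), i))
  exact h₃.symm.trans h₂

end LabeledSet

section

variable {p : ℕ} (φ : StrictFrobenius p finGamma isSpecial_finGamma)

/-- One stage later the set has at least four elements, so its symmetric group has trivial centre.
The extra stage is needed because for `p = 2` the set `a` may have only two elements. -/
lemma exists_not_comm_stageFunctor (hp : 2 ≤ p) {a : LabeledSet .pt} (ha : p ≤ Nat.card a.supp) {g : a ⟶ a}
    (hg : g ≠ 𝟙 a) (k : ℕ) : ∃ h : (stageFunctor φ .pt k).obj a ⟶ (stageFunctor φ .pt k).obj a,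
      (stageFunctor φ .pt k).map g ≫ h ≠ h ≫ (stageFunctor φ .pt k).map g := by
  have := faithful_frobFunctor φ (by lia : 0 < p)
  have := faithful_stageFunctor φ (by lia : 0 < p) (k + 1)
  rw [stageFunctor_eq]
  have hg' : (frobFunctor φ).map g ≠ 𝟙 _ := fun h =>
    hg ((frobFunctor φ).map_injective (h.trans ((frobFunctor φ).map_id a).symm))
  obtain ⟨h, hh⟩ := LabeledSet.exists_not_comm
    (by rw [card_frobFunctor]; exact le_trans (by lia) (Nat.mul_le_mul (hp.trans ha) hp)) hg'
  refine ⟨(stageFunctor φ .pt (k + 1)).map h, fun e => hh ?_⟩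
  apply (stageFunctor φ .pt (k + 1)).map_injective
  rw [Functor.map_comp, Functor.map_comp]
  exact e

/-- This applies `permutation_central` to edge groupoids of the telescope, with `a` the image of the
one-element set and `y` the image of its `p` separately labelled copies. -/
lemma permTimes_central (h : IsPPerfect p (telescope φ)) (π : Equiv.Perm (Fin p))
    (w : (stageFunctor φ .pt 0).obj ((LabeledSet.times p).obj .one) ⟶
      (stageFunctor φ .pt 0).obj ((LabeledSet.times p).obj .one)) :
    (stageFunctor φ .pt 0).map (LabeledSet.permTimes π) ≫ w =
      w ≫ (stageFunctor φ .pt 0).map (LabeledSet.permTimes π) := by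
  let X := (telescope φ).obj .pt
  let W := (telescope φ).obj ((FinStar.smash p).obj .pt)
  let Q := (powFunctor (Fin p)).obj X
  let d : X ⟶ Q := (diagonal p (telescope φ)).app .pt
  let s : W ⟶ Q := (smashSegal p (telescope φ)).app .pt
  let f : W ⟶ X := (foldMap p (telescope φ)).app .pt
  have : (EdgeCat.map s).IsEquivalence :=
    isEquivalence_edgeCatMap (smashSegal_weakEq p (isSpecial_telescope φ) .pt)
  -- Being `p`-perfect is used only here; the resulting equivalence supplies the fullness that
  -- centrality requires.
  have hR := isEquivalence_of_zigzag d s f (EdgeCat.map s).inv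
    (EdgeCat.map s).asEquivalence.counitIso (exists_isIso_of_isPPerfect h)
  let J := stageFunctor φ ((FinStar.smash p).obj .pt) 0
  let J' := stageFunctor φ .pt 0
  let c := (LabeledSet.copies p .pt).obj LabeledSet.one
  let τ := FinStar.smashPerm π .pt
  let t := EdgeCat.map ((telescope φ).map τ)
  have hσ (k : Fin p) : t ⋙ EdgeCat.map s ⋙ EdgeCat.map (powEval (Fin p) X k) =
      EdgeCat.map s ⋙ EdgeCat.map (powEval (Fin p) X (π.symm k)) := by
    refine congrArg (fun q => EdgeCat.map (X := W) (Y := X) q) (?_ : (telescope φ).map τ ≫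
      (telescope φ).map ((FinStar.smashProj p k).app .pt) =
        (telescope φ).map ((FinStar.smashProj p (π.symm k)).app .pt))
    rw [← Functor.map_comp, FinStar.smashPerm_proj]
  have hψ : t ⋙ EdgeCat.map f = EdgeCat.map f := by
    refine congrArg (fun q => EdgeCat.map (X := W) (Y := X) q) (?_ : (telescope φ).map τ ≫
      (telescope φ).map ((FinStar.smashFold p).app .pt) =
        (telescope φ).map ((FinStar.smashFold p).app .pt))
    rw [← Functor.map_comp, FinStar.smashPerm_fold]
  have hJ (k : Fin p) : J ⋙ EdgeCat.map s ⋙ EdgeCat.map (powEval (Fin p) X k) =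
      LabeledSet.push ((FinStar.smashProj p k).app .pt) ⋙ J' :=
    stageFunctor_naturality φ ((FinStar.smashProj p k).app .pt) 0
  have hF : J ⋙ EdgeCat.map f = LabeledSet.push ((FinStar.smashFold p).app .pt) ⋙ J' :=
    stageFunctor_naturality φ ((FinStar.smashFold p).app .pt) 0
  have ht : J ⋙ t = LabeledSet.push τ ⋙ J := stageFunctor_naturality φ τ 0
  let ε : (EdgeCat.map s).obj (J.obj c) ≅ (EdgeCat.map d).obj (J'.obj LabeledSet.one) :=
    EdgeCat.piIso fun k => eqToIso (Functor.congr_obj (hJ k) c) ≪≫ J'.mapIso ((copyIso p k .pt).symm.app _)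
  -- `t` only permutes the labels; permuting the elements accordingly leads back to the original
  -- labelled set.
  let θ : t.obj (J.obj c) ⟶ J.obj c :=
    eqToHom (Functor.congr_obj ht c) ≫ J.map (LabeledSet.permCopies π)
  have := permutation_central (EdgeCat.map s) (EdgeCat.map s).inv
    (EdgeCat.map s).asEquivalence.counitIso (EdgeCat.map d) (EdgeCat.map f)
    (fun k => EdgeCat.map (powEval (Fin p) X k)) (fun u v => EdgeCat.pi_ext u v)
    (fun k => Iso.refl (𝟭 _)) π.symm t (fun k => eqToIso (hσ k)) (eqToIso hψ) ε θ
    (fun k => by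
      have hc : (LabeledSet.push ((FinStar.smashProj p k).app .pt)).obj
          ((LabeledSet.push τ).obj c) =
            (LabeledSet.push ((FinStar.smashProj p (π.symm k)).app .pt)).obj c :=
        congrArg (fun q => (LabeledSet.push q).obj c) (FinStar.smashPerm_proj π .pt k)
      have hA := Functor.congr_obj
        (congrArg (· ⋙ EdgeCat.map s ⋙ EdgeCat.map (powEval (Fin p) X k)) ht) c
      have hC := Functor.congr_obj (hJ k) c
      have hB := Functor.congr_obj (hJ k) ((LabeledSet.push τ).obj c)
      have h₁ := Functor.congr_hom (hJ k) (LabeledSet.permCopies π)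
      have h₂ : (EdgeCat.map (powEval (Fin p) X k)).map ((EdgeCat.map s).map θ) =
        eqToHom hA ≫ (J ⋙ EdgeCat.map s ⋙ EdgeCat.map (powEval (Fin p) X k)).map (LabeledSet.permCopies π) := by
        simp only [θ, Functor.map_comp, eqToHom_map]
        rfl
      rw [h₂, h₁]
      let i (k : Fin p) := (copyIso p k .pt).app LabeledSet.one
      let u := (LabeledSet.push ((FinStar.smashProj p k).app .pt)).map (LabeledSet.permCopies π)
      have hu : u = eqToHom hc ≫ (i (π.symm k)).inv ≫ (i k).hom := by
        rw [← Category.assoc, ← Iso.comp_inv_eq]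
        exact LabeledSet.hom_one_ext _ _
      change eqToHom hA ≫ eqToHom hB ≫ J'.map u ≫ eqToHom hC.symm =
        (eqToHom (hσ k)).app (J.obj c) ≫ (eqToHom (Functor.congr_obj (hJ (π.symm k)) c) ≫
          J'.map (i (π.symm k)).inv) ≫ 𝟙 _ ≫ 𝟙 _ ≫ J'.map (i k).hom ≫ eqToHom hC.symm
      rw [eqToHom_app, Category.assoc, Category.id_comp, Category.id_comp, eqToHom_trans_assoc,
        eqToHom_trans_assoc, ← Functor.map_comp_assoc, ← Category.assoc, ← Category.assoc]
      exact congrArg (· ≫ eqToHom hC.symm) (eqToHom_comp_map J' hc _ _ _ _ hu))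
  -- Once the labels are folded together, the permutation of the summands becomes the permutation of
  -- the `p` elements, up to transport along equalities of objects.
  have hz : (eqToIso hψ).inv.app (J.obj c) ≫ (EdgeCat.map f).map θ =
      eqToHom (Functor.congr_obj hF c) ≫ J'.map (LabeledSet.permTimes π) ≫
        eqToHom (Functor.congr_obj hF c).symm := by
    have h₁ := Functor.congr_hom hF (LabeledSet.permCopies π)
    have h₂ : (EdgeCat.map f).map θ =
        eqToHom (Functor.congr_obj (congrArg (· ⋙ EdgeCat.map f) ht) c) ≫
          (J ⋙ EdgeCat.map f).map (LabeledSet.permCopies π) := by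
      simp only [θ, Functor.map_comp, eqToHom_map]
      rfl
    rw [h₂, h₁, eqToIso.inv, eqToHom_app, eqToHom_trans_assoc, eqToHom_trans_assoc]
    rfl
  rw [hz] at this
  have := this (eqToHom (Functor.congr_obj hF c) ≫ w ≫ eqToHom (Functor.congr_obj hF c).symm)
  simp only [Category.assoc, eqToHom_trans_assoc, eqToHom_refl, Category.id_comp] at this
  rw [← cancel_epi (eqToHom (Functor.congr_obj hF c)),
    ← cancel_mono (eqToHom (Functor.congr_obj hF c).symm), Category.assoc, Category.assoc,
    Category.assoc, Category.assoc]
  exact this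

/-- The telescope of the groupoid of finite sets is not `p`-perfect. -/
lemma not_isPPerfect_telescope (hp : 2 ≤ p) : ¬ IsPPerfect p (telescope φ) := by
  intro h
  have : Nontrivial (Fin p) := Fin.nontrivial_iff_two_le.2 hp
  obtain ⟨π, hπ⟩ := exists_ne (1 : Equiv.Perm (Fin p))
  obtain ⟨w, hw⟩ := exists_not_comm_stageFunctor φ hp (a := (LabeledSet.times p).obj .one)
    (by rw [LabeledSet.card_times, LabeledSet.card_one, one_mul]) (LabeledSet.permTimes_ne_id hπ) 0
  exact hw (permTimes_central φ h π w)

end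

/-! ### The fundamental group of the telescope -/

section

variable (X : SSet.{0}) [X.IsStrictSegal]

/-- The functor from the category of edges to the homotopy category. -/
noncomputable def EdgeCat.toHoCat : EdgeCat X ⥤ SSet.hoFunctor.obj X where
  obj x := (SSet.hoFunctor.obj.equiv X).symm x.pt
  map e := Truncated.HomotopyCategory.homMk (Edge.toTruncated (X := X) e)
  map_id _ := Truncated.HomotopyCategory.homMk_id _
  map_comp e e' := (Truncated.HomotopyCategory.homMk_comp_homMk
    (exists_compStruct (X := X) e e').choose_spec.some.toTruncated).symm

/-- The functor from the homotopy category to the category of edges. -/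
noncomputable def EdgeCat.ofHoCat : SSet.hoFunctor.obj X ⥤ EdgeCat X :=
  Truncated.HomotopyCategory.lift (V := (truncation 2).obj X) (fun x => (⟨x⟩ : EdgeCat X))
    (fun e => Edge.ofTruncated e) (fun _ => rfl) (fun h => EdgeCat.comp_eq (Edge.CompStruct.ofTruncated h))

lemma EdgeCat.ofHoCat_map {x y : EdgeCat X} (e : x ⟶ y) :
    (EdgeCat.ofHoCat X).map ((EdgeCat.toHoCat X).map e) = e :=
  Truncated.HomotopyCategory.lift_map_homMk (V := (truncation 2).obj X)
    (fun x => (⟨x⟩ : EdgeCat X)) (fun e => Edge.ofTruncated e) (fun _ => rfl)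
    (fun h => EdgeCat.comp_eq (Edge.CompStruct.ofTruncated h)) (Edge.toTruncated (X := X) e)

/-- The functor from the category of edges to the fundamental groupoid. -/
noncomputable def EdgeCat.toGroupoid : EdgeCat X ⥤ FreeGroupoid (SSet.hoFunctor.obj X) :=
  EdgeCat.toHoCat X ⋙ FreeGroupoid.of _

/-- As the edge category is already a groupoid, `ofHoCat` extends over the free groupoid and gives a
retraction on morphisms. -/
instance [HasInverses X] : (EdgeCat.toGroupoid X).Faithful where
  map_injective {x y e e'} h := by
    let : Groupoid (EdgeCat X) := Groupoid.ofIsGroupoid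
    have := congrArg (FreeGroupoid.lift (EdgeCat.ofHoCat X)).map h
    refine (EdgeCat.ofHoCat_map X e).symm.trans (Eq.trans ?_ (EdgeCat.ofHoCat_map X e'))
    exact (FreeGroupoid.lift_map_homMk (EdgeCat.ofHoCat X) _).symm.trans
      (this.trans (FreeGroupoid.lift_map_homMk (EdgeCat.ofHoCat X) _))

end

lemma mapAut_injective {C D : Type*} [Category C] [Category D] (F : C ⥤ D) [F.Faithful] (x : C) :
    Function.Injective (F.mapAut x) := fun _ _ h =>
  Iso.ext (F.map_injective (congrArg Iso.hom h))

variable {p : ℕ} (φ : StrictFrobenius p finGamma isSpecial_finGamma)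

/-- Automorphism groups of representatives of `1` at later stages embed in the fundamental group. -/
lemma exists_aut_embedding (hp : 0 < p) {k : ℕ} {a : LabeledSet .pt}
    (h : (stageFunctor φ .pt k).obj a = (stageFunctor φ .pt 0).obj .one) :
    ∃ ψ : Aut a →* π₁ (underlying (telescope φ))
      (((toTelescope φ).app .pt).app (.op ⦋0⦌) onePoint), Function.Injective ψ := by
  have := faithful_stageFunctor φ hp k
  let F := EdgeCat.toGroupoid ((telescope φ).obj .pt)
  refine ⟨(F.mapAut ((stageFunctor φ .pt 0).obj .one)).comp
    ((Aut.autMulEquivOfIso (eqToIso h)).toMonoidHom.comp ((stageFunctor φ .pt k).mapAut a)), ?_⟩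
  exact (mapAut_injective F _).comp
    ((Aut.autMulEquivOfIso (eqToIso h)).injective.comp (mapAut_injective (stageFunctor φ .pt k) a))

/-- The base point is also the image of a `p`-element set at stage one, whose permutations act by
automorphisms. -/
lemma exists_perm_embedding (hp : 0 < p) : ∃ ρ : Equiv.Perm (Fin p) →* π₁ (underlying (telescope φ))
    (((toTelescope φ).app .pt).app (.op ⦋0⦌) onePoint), Function.Injective ρ := by
  obtain ⟨ψ, hψ⟩ := exists_aut_embedding φ hp (k := 1) (a := (frobFunctor φ).obj .one)
    (Functor.congr_obj (stageFunctor_eq φ 0) LabeledSet.one).symm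
  have e : Fin p ≃ ((frobFunctor φ).obj .one).supp := (Finite.equivFinOfCardEq (by
    rw [card_frobFunctor, LabeledSet.card_one, one_mul])).symm
  exact ⟨ψ.comp ((LabeledSet.permAut _).comp e.permCongrHom.toMonoidHom),
    hψ.comp ((LabeledSet.permAut_injective _).comp e.permCongrHom.injective)⟩

/-- Stage two is used because its representative of the base point has `p² ≥ 4` elements; for `p =
2` the group at stage one is abelian. -/
lemma exists_mul_ne_mul (hp : 2 ≤ p) : ∃ a b : π₁ (underlying (telescope φ))
    (((toTelescope φ).app .pt).app (.op ⦋0⦌) onePoint), a * b ≠ b * a := by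
  let a := (frobFunctor φ).obj ((frobFunctor φ).obj .one)
  obtain ⟨ψ, hψ⟩ := exists_aut_embedding φ (by lia) (k := 2) (a := a)
    ((Functor.congr_obj (stageFunctor_eq φ 0) LabeledSet.one).trans
      (Functor.congr_obj (stageFunctor_eq φ 1) ((frobFunctor φ).obj .one))).symm
  have ha : 4 ≤ Nat.card a.supp := by
    rw [card_frobFunctor, card_frobFunctor, LabeledSet.card_one, one_mul]
    exact Nat.mul_le_mul hp hp
  obtain ⟨g, hg⟩ := LabeledSet.exists_ne_id (a := a) (by lia)
  obtain ⟨h, hgh⟩ := LabeledSet.exists_not_comm (by lia) hg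
  -- Multiplication in `Aut` is composition in the opposite order, hence `h` comes before `g`.
  refine ⟨ψ ((Groupoid.isoEquivHom a a).symm h), ψ ((Groupoid.isoEquivHom a a).symm g), fun e => ?_⟩
  have := hψ ((ψ.map_mul _ _).trans (e.trans (ψ.map_mul _ _).symm))
  exact hgh (congrArg Iso.hom this)

end EInfty

open CategoryTheory Simplicial EInfty

theorem mainTheorem7 (p : ℕ) (hp : 2 ≤ p)
    (φ : StrictFrobenius p finGamma isSpecial_finGamma) :
    IsSpecial (telescope φ) ∧
    ¬ IsPPerfect p (telescope φ) ∧
    (∀ (L : GammaSpace) (η : toHo.obj finGamma ⟶ toHo.obj L), IsPPerfection p η →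
      ∀ c : toHo.obj (telescope φ) ⟶ toHo.obj L, toHo.map (toTelescope φ) ≫ c = η → ¬ IsIso c) ∧
    (∃ ρ : Equiv.Perm (Fin p) →* π₁ (underlying (telescope φ))
        (((toTelescope φ).app .pt).app (.op ⦋0⦌) onePoint), Function.Injective ρ) ∧
    ∃ a b : π₁ (underlying (telescope φ))
        (((toTelescope φ).app .pt).app (.op ⦋0⦌) onePoint), a * b ≠ b * a :=
  ⟨isSpecial_telescope φ, not_isPPerfect_telescope φ hp,
    -- An invertible `c` would carry the perfectness of `L` back to the telescope.
    fun _ _ hη c _ _ => not_isPPerfect_telescope φ hp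
      (isPPerfect_of_iso p (isSpecial_telescope φ) (asIso c) hη.perfect),
    exists_perm_embedding φ (by lia), exists_mul_ne_mul φ hp⟩
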